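/- **Theorem.** Let $E$ be a real Hilbert space with a countably infinite orthonormal basis, and let $\mathcal E=\{e_j\}_{j\in\mathbb N}$ be an orthonormal basis of $E$. *Rectangles.* For $a,b\in\ell_\infty$ put $\Pi_{\mathcal E}(a,b)=\{x\in E:\ (x,e_j)\in[a_j,b_j)\ \ \forall j\in\mathbb N\}$. Let $\mathcal K_{\mathcal E}$ consist of $\varnothing$ and of all nonempty sets $\Pi_{\mathcal E}(a,b)$ with $a,b\in\ell_\infty$ and $\sum_{j}\max\{0,\ln(b_j-a_j)\}<\infty$ (the measurable $\mathcal E$-rectangles). *Measure on the generated ring.* Let $r_{\mathcal E}$ be the ring of subsets of $E$ generated by $\mathcal K_{\mathcal E}$. Let $\lambda_{\mathcal E}:r_{\mathcal E}\to[0,\infty)$ be the unique finitely additive function with $\lambda_{\mathcal E}(\varnothing)=0$ and $\lambda_{\mathcal E}(\Pi_{\mathcal E}(a,b))=\exp\bigl(\sum_{j}\ln(b_j-a_j)\bigr)$ for every nonempty $\Pi_{\mathcal E}(a,b)\in\mathcal K_{\mathcal E}$, where $\exp(-\infty)=0$. *Completion.* Let $\mathcal R_{\mathcal E}$ be the collection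 of all $A\subset E$ such that for every $\varepsilon>0$ there are $A_*,A^*\in r_{\mathcal E}$ with $A_*\subset A\subset A^*$ and $\lambda_{\mathcal E}(A^*\setminus A_*)<\varepsilon$. For $A\in\mathcal R_{\mathcal E}$ put $\lambda_{\mathcal E}(A)=\inf\{\lambda_{\mathcal E}(A^*):\ A^*\in r_{\mathcal E},\ A\subset A^*\}$. Let $\mathcal E=\{e_i\}$ and $\mathcal F=\{f_j\}$ be two orthonormal bases of $E$ such that $$\prod_{j=1}^{\infty}\ \sum_{i=1}^{\infty}|(e_i,f_j)|<+\infty .$$ Then: 1. if $Q\in\mathcal K_{\mathcal F}$, then $Q\in\mathcal R_{\mathcal E}$ and $\lambda_{\mathcal E}(Q)=\lambda_{\mathcal F}(Q)$; 2. if $P\in\mathcal K_{\mathcal E}$, then $P\in\mathcal R_{\mathcal F}$ and $\lambda_{\mathcal F}(P)=\lambda_{\mathcal E}(P)$. -/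

import Mathlib

noncomputable section

open MeasureTheory Filter Topology
open scoped ENNReal

/-- `exp (∑ ln (b j - a j))`, the infinite product of the edge lengths of a rectangle. For a nonempty
measurable rectangle the positive parts of the logarithms are summable, so the series of the
logarithms either converges absolutely or diverges to `-∞`; in the second case the value is `0`. -/
def edgeProduct (a b : ℕ → ℝ) : ℝ :=
  open Classical in
  if Summable (fun j => Real.log (b j - a j)) then
    Real.exp (∑' j, Real.log (b j - a j)) else 0

/-- `edgeProduct` is the limit of the finite products of the edge lengths. -/
theorem tendsto_edgeProduct {a b : ℕ → ℝ} (hab : ∀ j, a j < b j)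
    (hm : Summable fun j => max 0 (Real.log (b j - a j))) :
    Tendsto (fun n => ∏ j ∈ Finset.range n, (b j - a j)) atTop (𝓝 (edgeProduct a b)) := by
  have hprod : ∀ n, ∏ j ∈ Finset.range n, (b j - a j)
      = Real.exp (∑ j ∈ Finset.range n, Real.log (b j - a j)) := by
    intro n
    rw [Real.exp_sum]
    exact Finset.prod_congr rfl fun j _ => (Real.exp_log (sub_pos.2 (hab j))).symm
  simp_rw [hprod]
  unfold edgeProduct
  split_ifs with h
  · exact (Real.continuous_exp.tendsto _).comp h.hasSum.tendsto_sum_nat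
  · refine Real.tendsto_exp_atBot.comp ?_
    have hn : ¬ Summable fun j => max 0 (Real.log (b j - a j)) - Real.log (b j - a j) := by
      intro h'
      exact h ((hm.sub h').congr fun j => by ring)
    have h1 := (not_summable_iff_tendsto_nat_atTop_of_nonneg
      (fun j => sub_nonneg.2 (le_max_right _ _))).1 hn
    have h2 := hm.hasSum.tendsto_sum_nat.add_atBot (tendsto_neg_atTop_atBot.comp h1)
    refine h2.congr fun n => ?_
    simp [Finset.sum_sub_distrib]

theorem summable_sq_of_abs_sub_le {y z d : ℕ → ℝ} (hz : Summable fun j => z j ^ 2)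
    (hd : Summable d) (h : ∀ᶠ j in atTop, |y j - z j| ≤ d j) : Summable fun j => y j ^ 2 := by
  have hd' : ∀ᶠ j in atTop, d j ≤ 1 :=
    (hd.tendsto_atTop_zero.eventually (ge_mem_nhds zero_lt_one))
  refine Summable.of_norm_bounded_eventually_nat
    (g := fun j => 2 * z j ^ 2 + 2 * d j) ((hz.mul_left 2).add (hd.mul_left 2)) ?_
  filter_upwards [h, hd'] with j h1 h2
  have h0 : 0 ≤ d j := (abs_nonneg _).trans h1
  have h3 : (y j - z j) ^ 2 ≤ d j := by
    rw [← sq_abs]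
    nlinarith [abs_nonneg (y j - z j)]
  rw [Real.norm_of_nonneg (sq_nonneg _)]
  nlinarith [sq_nonneg (y j - 2 * z j)]

/-- Nearness of two edge families up to a summable error. -/
def edgeSetoid {ι : Type*} (a b : ι → ℕ → ℝ) : Setoid ι where
  r i i' := Summable (fun j => |a i j - a i' j|) ∧ Summable (fun j => |b i j - b i' j|)
  iseqv := by
    have ht : ∀ u v w : ℕ → ℝ, Summable (fun j => |u j - v j|) → Summable (fun j => |v j - w j|) →
        Summable (fun j => |u j - w j|) := fun u v w h1 h2 =>
      Summable.of_nonneg_of_le (fun _ => abs_nonneg _) (fun j => abs_sub_le _ _ _) (h1.add h2)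
    refine ⟨fun i => by simp [summable_zero], fun h => ?_, fun h h' => ⟨ht _ _ _ h.1 h'.1, ht _ _ _ h.2 h'.2⟩⟩
    simpa only [abs_sub_comm] using h

/-- If the logarithms are summable, the lengths differ from one by a summable error. -/
theorem summable_length_sub_one {l : ℕ → ℝ} (hl : ∀ j, 0 < l j)
    (h : Summable fun j => Real.log (l j)) : Summable fun j => |l j - 1| := by
  have h0 := h.abs
  refine Summable.of_norm_bounded_eventually_nat (h0.mul_left 2) ?_
  filter_upwards [h0.tendsto_atTop_zero.eventually (ge_mem_nhds zero_lt_one)] with j hj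
  have := Real.abs_exp_sub_one_le hj
  rw [Real.exp_log (hl j)] at this
  simpa using this

theorem sum_prefix_nonneg {ι : Type*} (s : Finset ι) (c : ι → ℝ) (a b : ι → ℕ → ℝ) (n : ℕ)
    (hab : ∀ i ∈ s, ∀ j, a i j < b i j)
    (h : ∀ x : Fin n → ℝ, 0 ≤ ∑ i ∈ s, c i *
      (Set.pi Set.univ fun j : Fin n => Set.Ico (a i j) (b i j)).indicator 1 x) :
    0 ≤ ∑ i ∈ s, c i * ∏ j ∈ Finset.range n, (b i j - a i j) := by
  have hmeas : ∀ i, MeasurableSet (Set.pi Set.univ fun j : Fin n => Set.Ico (a i j) (b i j)) :=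
    fun i => MeasurableSet.univ_pi fun j => measurableSet_Ico
  have hint : ∀ i, Integrable (fun x => c i *
      (Set.pi Set.univ fun j : Fin n => Set.Ico (a i j) (b i j)).indicator (1 : (Fin n → ℝ) → ℝ) x) := by
    intro i
    refine Integrable.const_mul ?_ _
    refine (integrable_indicator_iff (hmeas i)).2 ?_
    refine integrableOn_const ?_
    rw [Real.volume_pi_Ico]
    exact (ENNReal.prod_lt_top fun j _ => ENNReal.ofReal_lt_top).ne
  have h1 : 0 ≤ ∫ x : Fin n → ℝ, ∑ i ∈ s, c i *
      (Set.pi Set.univ fun j : Fin n => Set.Ico (a i j) (b i j)).indicator (1 : (Fin n → ℝ) → ℝ) x :=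
    integral_nonneg h
  rw [integral_finsetSum _ fun i _ => hint i] at h1
  refine h1.trans_eq (Finset.sum_congr rfl fun i hi => ?_)
  rw [integral_const_mul, integral_indicator_one (hmeas i), Measure.real,
    Real.volume_pi_Ico_toReal (a := fun j : Fin n => a i j) (fun j => (hab i hi j).le), Finset.prod_range (fun j => b i j - a i j)]


theorem edge_near_of_tail_subset {a₀ b₀ d a b : ℕ → ℝ} (hab : ∀ j, a j < b j)
    (hm : Summable fun j => max 0 (Real.log (b j - a j)))
    (h₀ : Summable fun j => |b₀ j - a₀ j - 1|) (hd : Summable d)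
    (h : ∀ᶠ j in atTop, a j ≤ a₀ j + d j ∧ b₀ j - d j ≤ b j) :
    Summable (fun j => |a j - a₀ j|) ∧ Summable (fun j => |b j - b₀ j|) := by
  have key : ∀ᶠ j in atTop, |a j - a₀ j| ≤ 2 * |d j| + |b₀ j - a₀ j - 1| +
        2 * max 0 (Real.log (b j - a j)) ∧
      |b j - b₀ j| ≤ 2 * |d j| + |b₀ j - a₀ j - 1| + 2 * max 0 (Real.log (b j - a j)) := by
    filter_upwards [h, hm.tendsto_atTop_zero.eventually (ge_mem_nhds zero_lt_one)] with j hj hj1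
    set m := max 0 (Real.log (b j - a j)) with hmdef
    have hm0 : 0 ≤ m := le_max_left _ _
    have hlen : b j - a j ≤ 1 + 2 * m := by
      have h1 : b j - a j ≤ Real.exp m := by
        rw [← Real.exp_log (sub_pos.2 (hab j))]
        exact Real.exp_le_exp.2 (le_max_right _ _)
      have h2 := Real.abs_exp_sub_one_le (x := m) (by rwa [abs_of_nonneg hm0])
      rw [abs_of_nonneg hm0] at h2
      linarith [le_abs_self (Real.exp m - 1)]
    have h3 := abs_le.1 (le_refl |d j|)
    have h4 := abs_le.1 (le_refl |b₀ j - a₀ j - 1|)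
    constructor <;> rw [abs_le] <;> constructor <;> linarith [hj.1, hj.2]
  have hs := ((hd.abs.mul_left 2).add h₀).add (hm.mul_left 2)
  constructor
  · refine Summable.of_norm_bounded_eventually_nat hs ?_
    filter_upwards [key] with j hj
    simpa using hj.1
  · refine Summable.of_norm_bounded_eventually_nat hs ?_
    filter_upwards [key] with j hj
    simpa using hj.2

theorem exists_tail_point {ι : Type*} (t : Finset ι) (a b : ι → ℕ → ℝ) (α β : ℕ → ℝ) (n : ℕ)
    (hαβ : ∀ j, n ≤ j → α j < β j)
    (y₀ : ℕ → ℝ) (hy₀ : Summable fun j => y₀ j ^ 2) (hy₀' : ∀ j, n ≤ j → y₀ j ∈ Set.Ico (α j) (β j))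
    (ht : ∀ i ∈ t, ¬ ∀ᶠ j in atTop, a i j ≤ α j ∧ β j ≤ b i j) :
    ∃ y : ℕ → ℝ, (Summable fun j => y j ^ 2) ∧ (∀ j, n ≤ j → y j ∈ Set.Ico (α j) (β j)) ∧
      ∀ i ∈ t, ∃ j, n ≤ j ∧ y j ∉ Set.Ico (a i j) (b i j) := by
  classical
  suffices ∃ (y : ℕ → ℝ) (M : ℕ), (Summable fun j => y j ^ 2) ∧
      (∀ j, n ≤ j → y j ∈ Set.Ico (α j) (β j)) ∧
      ∀ i ∈ t, ∃ j, n ≤ j ∧ j < M ∧ y j ∉ Set.Ico (a i j) (b i j) by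
    obtain ⟨y, M, h1, h2, h3⟩ := this
    exact ⟨y, h1, h2, fun i hi => by obtain ⟨j, hj, -, hj'⟩ := h3 i hi; exact ⟨j, hj, hj'⟩⟩
  induction t using Finset.induction_on with
  | empty => exact ⟨y₀, 0, hy₀, hy₀', by simp⟩
  | insert i t hi ih =>
    obtain ⟨y, M, h1, h2, h3⟩ := ih fun k hk => ht k (Finset.mem_insert_of_mem hk)
    have hb := ht i (Finset.mem_insert_self _ _)
    rw [Filter.not_eventually, Filter.frequently_atTop] at hb
    obtain ⟨j, hj, hbad⟩ := hb (max n M)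
    have hnj : n ≤ j := (le_max_left _ _).trans hj
    have hMj : M ≤ j := (le_max_right _ _).trans hj
    obtain ⟨v, hv, hv'⟩ : ∃ v ∈ Set.Ico (α j) (β j), v ∉ Set.Ico (a i j) (b i j) := by
      rcases lt_or_ge (α j) (a i j) with h | h
      · exact ⟨α j, ⟨le_rfl, hαβ j hnj⟩, fun h' => absurd h'.1 (not_le.2 h)⟩
      · have h' : b i j < β j := by
          by_contra hc
          exact hbad ⟨h, not_lt.1 hc⟩
        exact ⟨max (α j) (b i j), ⟨le_max_left _ _, max_lt (hαβ j hnj) h'⟩,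
          fun h'' => absurd h''.2 (not_lt.2 (le_max_right _ _))⟩
    refine ⟨Function.update y j v, j + 1, ?_, ?_, ?_⟩
    · refine summable_sq_of_abs_sub_le (d := fun _ => 0) h1 summable_zero ?_
      filter_upwards [eventually_gt_atTop j] with k hk
      simp [Function.update_of_ne hk.ne']
    · intro k hk
      rcases eq_or_ne k j with rfl | hkj
      · simpa using hv
      · simpa [Function.update_of_ne hkj] using h2 k hk
    · intro k hk
      rcases Finset.mem_insert.1 hk with rfl | hk
      · exact ⟨j, hnj, Nat.lt_succ_self j, by simpa using hv'⟩
      · obtain ⟨l, hl, hlM, hl'⟩ := h3 k hk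
        have : l ≠ j := (hlM.trans_le hMj).ne
        exact ⟨l, hl, by omega, by simpa [Function.update_of_ne this] using hl'⟩

open Classical in
theorem sum_class_nonneg {ι : Type*} (s : Finset ι) (c : ι → ℝ) (a b : ι → ℕ → ℝ)
    (hab : ∀ i ∈ s, ∀ j, a i j < b i j)
    (hm : ∀ i ∈ s, Summable fun j => max 0 (Real.log (b i j - a i j)))
    (h : ∀ x : ℕ → ℝ, (Summable fun j => x j ^ 2) →
      0 ≤ ∑ i ∈ s, c i * (if ∀ j, x j ∈ Set.Ico (a i j) (b i j) then 1 else 0))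
    (i₀ : ι) (hi₀ : i₀ ∈ s) (hlog : Summable fun j => Real.log (b i₀ j - a i₀ j))
    (z : ℕ → ℝ) (hz : Summable fun j => z j ^ 2) (hz' : ∀ j, z j ∈ Set.Ico (a i₀ j) (b i₀ j)) :
    0 ≤ ∑ i ∈ s with (edgeSetoid a b).r i i₀, c i * edgeProduct (a i) (b i) := by
  set q := s.filter fun i => (edgeSetoid a b).r i i₀ with hq
  have hmem : ∀ i, i ∈ q ↔ i ∈ s ∧ (Summable (fun j => |a i j - a i₀ j|) ∧
      Summable (fun j => |b i j - b i₀ j|)) := by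
    intro i
    rw [hq, Finset.mem_filter]
    rfl
  set d : ℕ → ℝ := fun j => ∑ i ∈ q, (|a i j - a i₀ j| + |b i j - b i₀ j|) with hd
  have hdsum : Summable d := summable_sum fun i hi => ((hmem i).1 hi).2.1.add ((hmem i).1 hi).2.2
  have hd0 : ∀ j, 0 ≤ d j := fun j => Finset.sum_nonneg fun i _ => by positivity
  have hda : ∀ i ∈ q, ∀ j, |a i j - a i₀ j| + |b i j - b i₀ j| ≤ d j := fun i hi j =>
    Finset.single_le_sum (f := fun i => |a i j - a i₀ j| + |b i j - b i₀ j|)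
      (fun i _ => by positivity) hi
  have hlen := summable_length_sub_one (fun j => sub_pos.2 (hab i₀ hi₀ j)) hlog
  have hev : ∀ᶠ n in atTop, ∀ j, n ≤ j → a i₀ j + d j < b i₀ j - d j := by
    rw [eventually_forall_ge_atTop]
    filter_upwards [hdsum.tendsto_atTop_zero.eventually (gt_mem_nhds (show (0:ℝ) < 1/4 by norm_num)),
      hlen.tendsto_atTop_zero.eventually (gt_mem_nhds (show (0:ℝ) < 1/4 by norm_num))] with j h1 h2
    have := (abs_lt.1 h2).1
    linarith
  have hlim : Tendsto (fun n => ∑ i ∈ q, c i * ∏ j ∈ Finset.range n, (b i j - a i j)) atTop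
      (𝓝 (∑ i ∈ q, c i * edgeProduct (a i) (b i))) :=
    tendsto_finsetSum _ fun i hi => (tendsto_edgeProduct (hab i ((hmem i).1 hi).1)
      (hm i ((hmem i).1 hi).1)).const_mul _
  refine ge_of_tendsto hlim ?_
  filter_upwards [hev] with n hn
  obtain ⟨y, hy1, hy2, hy3⟩ := exists_tail_point (s \ q) a b (fun j => a i₀ j + d j)
    (fun j => b i₀ j - d j) n hn (fun j => max (a i₀ j + d j) (z j - d j))
    (summable_sq_of_abs_sub_le hz hdsum (Eventually.of_forall fun j => by
      have h1 := hd0 j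
      have h2 := (hz' j).1
      rw [abs_le]
      constructor
      · linarith [le_max_right (a i₀ j + d j) (z j - d j)]
      · rw [sub_le_iff_le_add]
        exact max_le (by linarith) (by linarith)))
    (fun j hj => ⟨le_max_left _ _, max_lt (hn j hj) (by linarith [(hz' j).2])⟩)
    (by
      intro i hi hc
      rw [Finset.mem_sdiff] at hi
      exact hi.2 ((hmem i).2 ⟨hi.1, edge_near_of_tail_subset (hab i hi.1) (hm i hi.1) hlen hdsum hc⟩))
  refine sum_prefix_nonneg q c a b n (fun i hi => hab i ((hmem i).1 hi).1) fun x => ?_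
  set w : ℕ → ℝ := fun j => if hj : j < n then x ⟨j, hj⟩ else y j with hw
  have hwn : ∀ j, n ≤ j → w j = y j := fun j hj => by simp [hw, not_lt.2 hj]
  have hwx : ∀ j : Fin n, w j = x j := fun j => by simp [hw]
  have hwsq : Summable fun j => w j ^ 2 :=
    summable_sq_of_abs_sub_le (d := fun _ => 0) hy1 summable_zero (by
      filter_upwards [eventually_ge_atTop n] with j hj
      simp [hwn j hj])
  refine (h w hwsq).trans_eq ?_
  rw [← Finset.sum_subset (Finset.filter_subset _ s : q ⊆ s)]
  · refine Finset.sum_congr rfl fun i hi => ?_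
    congr 1
    rw [Set.indicator_apply]
    refine if_congr ?_ rfl rfl
    constructor
    · intro hj j _
      rw [← hwx]
      exact hj j
    · intro hx j
      by_cases hj : j < n
      · have := hx ⟨j, hj⟩ (Set.mem_univ _)
        rwa [← hwx] at this
      · rw [hwn j (not_lt.1 hj)]
        have h1 := hy2 j (not_lt.1 hj)
        have h2 := hda i hi j
        have h3 := abs_le.1 (le_refl |a i j - a i₀ j|)
        have h4 := abs_le.1 (le_refl |b i j - b i₀ j|)
        have h5 := abs_nonneg (a i j - a i₀ j)
        have h6 := abs_nonneg (b i j - b i₀ j)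
        exact ⟨by linarith [h1.1], by linarith [h1.2]⟩
  · intro i hi hiq
    obtain ⟨j, hj, hj'⟩ := hy3 i (Finset.mem_sdiff.2 ⟨hi, hiq⟩)
    rw [if_neg, mul_zero]
    intro hc
    exact hj' (hwn j hj ▸ hc j)

open Classical in
theorem sum_edgeProduct_nonneg {ι : Type*} (s : Finset ι) (c : ι → ℝ) (a b : ι → ℕ → ℝ)
    (hne : ∀ i ∈ s, ∃ z : ℕ → ℝ, (Summable fun j => z j ^ 2) ∧ ∀ j, z j ∈ Set.Ico (a i j) (b i j))
    (hm : ∀ i ∈ s, Summable fun j => max 0 (Real.log (b i j - a i j)))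
    (h : ∀ x : ℕ → ℝ, (Summable fun j => x j ^ 2) →
      0 ≤ ∑ i ∈ s, c i * (if ∀ j, x j ∈ Set.Ico (a i j) (b i j) then 1 else 0)) :
    0 ≤ ∑ i ∈ s, c i * edgeProduct (a i) (b i) := by
  have hab : ∀ i ∈ s, ∀ j, a i j < b i j := by
    intro i hi j
    obtain ⟨z, -, hz⟩ := hne i hi
    exact (hz j).1.trans_lt (hz j).2
  rw [Finset.sum_partition (edgeSetoid a b)]
  refine Finset.sum_nonneg fun x hx => ?_
  obtain ⟨i₁, hi₁, rfl⟩ := Finset.mem_image.1 hx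
  by_cases hpos : ∃ i₀ ∈ s, (edgeSetoid a b).r i₀ i₁ ∧ Summable fun j => Real.log (b i₀ j - a i₀ j)
  · obtain ⟨i₀, hi₀, hr, hlog⟩ := hpos
    obtain ⟨z, hz, hz'⟩ := hne i₀ hi₀
    refine (sum_class_nonneg s c a b hab hm h i₀ hi₀ hlog z hz hz').trans_eq ?_
    refine Finset.sum_congr (Finset.filter_congr fun i _ => ?_) fun _ _ => rfl
    rw [Quotient.eq]
    exact ⟨fun h' => (edgeSetoid a b).trans h' hr, fun h' => (edgeSetoid a b).trans h' ((edgeSetoid a b).symm hr)⟩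
  · push Not at hpos
    refine (Finset.sum_eq_zero fun i hi => ?_).ge
    rw [Finset.mem_filter, Quotient.eq] at hi
    rw [edgeProduct, if_neg (hpos i hi.1 hi.2), mul_zero]


namespace HilbertBasis

variable {H : Type*} [NormedAddCommGroup H] [InnerProductSpace ℝ H]

/-- The set of all `x` whose `j`-th coordinate lies in `[a j, b j)` for every `j`. -/
def rectangle (e : HilbertBasis ℕ ℝ H) (a b : ℕ → ℝ) : Set H :=
  {x | ∀ j, inner ℝ (e j) x ∈ Set.Ico (a j) (b j)}

/-- `a` and `b` are the edge sequences of a nonempty measurable rectangle of the basis `e`. -/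
structure IsMeasurableEdges (e : HilbertBasis ℕ ℝ H) (a b : ℕ → ℝ) : Prop where
  memℓp_left : Memℓp a ∞
  memℓp_right : Memℓp b ∞
  nonempty : (e.rectangle a b).Nonempty
  summable : Summable fun j => max 0 (Real.log (b j - a j))

/-- The collection `K_e` of measurable rectangles of the basis `e`. -/
def measurableRectangles (e : HilbertBasis ℕ ℝ H) : Set (Set H) :=
  {P | P = ∅ ∨ ∃ a b, e.IsMeasurableEdges a b ∧ P = e.rectangle a b}

/-- The ring of sets `r_e` generated by the measurable rectangles of `e`. -/
def rectangleRing (e : HilbertBasis ℕ ℝ H) : Set (Set H) :=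
  ⋂₀ {C | IsSetRing C ∧ e.measurableRectangles ⊆ C}

theorem isSetRing_rectangleRing (e : HilbertBasis ℕ ℝ H) : IsSetRing e.rectangleRing where
  empty_mem := fun _ hC => hC.1.empty_mem
  union_mem := fun _ _ hs ht C hC => hC.1.union_mem (hs C hC) (ht C hC)
  sdiff_mem := fun _ _ hs ht C hC => hC.1.sdiff_mem (hs C hC) (ht C hC)

theorem measurableRectangles_subset (e : HilbertBasis ℕ ℝ H) :
    e.measurableRectangles ⊆ e.rectangleRing := fun _ hP _ hC => hC.2 hP

theorem inter_mem_measurableRectangles (e : HilbertBasis ℕ ℝ H) {P Q : Set H}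
    (hP : P ∈ e.measurableRectangles) (hQ : Q ∈ e.measurableRectangles) :
    P ∩ Q ∈ e.measurableRectangles := by
  rcases hP with rfl | ⟨a, b, h, rfl⟩
  · exact Or.inl (Set.empty_inter _)
  rcases hQ with rfl | ⟨a', b', h', rfl⟩
  · exact Or.inl (Set.inter_empty _)
  rcases Set.eq_empty_or_nonempty (e.rectangle a b ∩ e.rectangle a' b') with h0 | h0
  · exact Or.inl h0
  have heq : e.rectangle a b ∩ e.rectangle a' b' =
      e.rectangle (fun j => max (a j) (a' j)) (fun j => min (b j) (b' j)) := by
    ext x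
    simp only [rectangle, Set.mem_inter_iff, Set.mem_ofPred_eq, Set.mem_Ico, max_le_iff, lt_min_iff]
    exact ⟨fun h j => ⟨⟨(h.1 j).1, (h.2 j).1⟩, (h.1 j).2, (h.2 j).2⟩,
      fun h => ⟨fun j => ⟨(h j).1.1, (h j).2.1⟩, fun j => ⟨(h j).1.2, (h j).2.2⟩⟩⟩
  have hbd : ∀ u v w : ℕ → ℝ, Memℓp u ∞ → Memℓp v ∞ → (∀ j, |w j| ≤ max |u j| |v j|) →
      Memℓp w ∞ := by
    intro u v w hu hv hw
    obtain ⟨A, hA⟩ := memℓp_infty_iff.1 hu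
    obtain ⟨B, hB⟩ := memℓp_infty_iff.1 hv
    refine memℓp_infty_iff.2 ⟨max A B, ?_⟩
    rintro _ ⟨j, rfl⟩
    exact (hw j).trans (max_le_max (hA ⟨j, rfl⟩) (hB ⟨j, rfl⟩))
  rw [heq] at h0 ⊢
  refine Or.inr ⟨_, _, ⟨hbd _ _ _ h.1 h'.1 fun j => abs_max_le_max_abs_abs,
    hbd _ _ _ h.2 h'.2 fun j => abs_min_le_max_abs_abs, h0, ?_⟩, rfl⟩
  obtain ⟨x, hx⟩ := h0
  refine Summable.of_nonneg_of_le (fun j => le_max_left _ _) (fun j => ?_) h.summable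
  refine max_le_max le_rfl (Real.log_le_log ?_ ?_)
  · exact sub_pos.2 ((hx j).1.trans_lt (hx j).2)
  · exact sub_le_sub (min_le_left _ _) (le_max_left _ _)

theorem summable_sq_coord (e : HilbertBasis ℕ ℝ H) (x : H) :
    Summable fun j => (inner ℝ (e j) x) ^ 2 := by
  refine (e.summable_inner_mul_inner x x).congr fun j => ?_
  rw [real_inner_comm x (e j), sq]

theorem exists_coord_eq (e : HilbertBasis ℕ ℝ H) {y : ℕ → ℝ} (hy : Summable fun j => y j ^ 2) :
    ∃ x : H, ∀ j, inner ℝ (e j) x = y j := by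
  have hmem : Memℓp y 2 := memℓp_gen (by simpa using hy)
  refine ⟨e.repr.symm ⟨y, hmem⟩, fun j => ?_⟩
  rw [← e.repr_apply_apply, LinearIsometryEquiv.apply_symm_apply]

theorem sum_edgeProduct_nonneg (e : HilbertBasis ℕ ℝ H)
    (v : {p : (ℕ → ℝ) × (ℕ → ℝ) // e.IsMeasurableEdges p.1 p.2} →₀ ℝ)
    (h : 0 ≤ Finsupp.linearCombination ℝ
      (fun p : {p : (ℕ → ℝ) × (ℕ → ℝ) // e.IsMeasurableEdges p.1 p.2} =>
        (e.rectangle p.1.1 p.1.2).indicator (1 : H → ℝ)) v) :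
    0 ≤ Finsupp.linearCombination ℝ
      (fun p : {p : (ℕ → ℝ) × (ℕ → ℝ) // e.IsMeasurableEdges p.1 p.2} =>
        edgeProduct p.1.1 p.1.2) v := by
  classical
  rw [Finsupp.linearCombination_apply, Finsupp.sum]
  refine _root_.sum_edgeProduct_nonneg v.support v (fun p => p.1.1) (fun p => p.1.2) ?_ ?_ ?_
  · intro p _
    obtain ⟨x, hx⟩ := p.2.nonempty
    exact ⟨_, e.summable_sq_coord x, hx⟩
  · intro p _
    exact p.2.summable
  · intro y hy
    obtain ⟨x, hx⟩ := e.exists_coord_eq hy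
    have := h x
    rw [Finsupp.linearCombination_apply, Finsupp.sum, Finset.sum_apply] at this
    refine this.trans_eq (Finset.sum_congr rfl fun p _ => ?_)
    simp [Set.indicator_apply, rectangle, hx]

/-- The functional which sends the indicator of each measurable rectangle to its volume; it is
nonnegative on the nonnegative combinations of such indicators. -/
theorem exists_functional (e : HilbertBasis ℕ ℝ H) :
    ∃ L : (H → ℝ) →ₗ[ℝ] ℝ,
      (∀ a b, e.IsMeasurableEdges a b → L ((e.rectangle a b).indicator 1) = edgeProduct a b) ∧
      ∀ g ∈ Submodule.span ℝ {g : H → ℝ | ∃ P ∈ e.measurableRectangles, g = P.indicator 1},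
        0 ≤ g → 0 ≤ L g := by
  classical
  set S := {p : (ℕ → ℝ) × (ℕ → ℝ) // e.IsMeasurableEdges p.1 p.2} with hS
  set Φ := Finsupp.linearCombination ℝ (fun p : S => (e.rectangle p.1.1 p.1.2).indicator (1 : H → ℝ))
    with hΦ
  set Ψ := Finsupp.linearCombination ℝ (fun p : S => edgeProduct p.1.1 p.1.2) with hΨ
  have hpos : ∀ v, 0 ≤ Φ v → 0 ≤ Ψ v := e.sum_edgeProduct_nonneg
  have hker : ∀ v, Φ v = 0 → Ψ v = 0 := by
    intro v hv
    refine le_antisymm ?_ (hpos v hv.ge)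
    have := hpos (-v) (by rw [map_neg, hv, neg_zero])
    rw [map_neg] at this
    linarith
  obtain ⟨g, hg⟩ := Φ.rangeRestrict.exists_rightInverse_of_surjective Φ.range_rangeRestrict
  obtain ⟨L, hL⟩ := LinearMap.exists_extend (Ψ ∘ₗ g)
  have hLΦ : ∀ v, L (Φ v) = Ψ v := by
    intro v
    have h1 : L (Φ v) = Ψ (g (Φ.rangeRestrict v)) := LinearMap.congr_fun hL (Φ.rangeRestrict v)
    have h2 : Φ (g (Φ.rangeRestrict v)) = Φ v :=
      congrArg Subtype.val (LinearMap.congr_fun hg (Φ.rangeRestrict v))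
    have h3 := hker (g (Φ.rangeRestrict v) - v) (by rw [map_sub, h2, sub_self])
    rw [map_sub, sub_eq_zero] at h3
    rw [h1, h3]
  have hrect : ∀ a b, ∀ h : e.IsMeasurableEdges a b,
      Φ (Finsupp.single (⟨(a, b), h⟩ : S) 1) = (e.rectangle a b).indicator 1 := by
    intro a b h
    rw [hΦ, Finsupp.linearCombination_single, one_smul]
  refine ⟨L, ?_, ?_⟩
  · intro a b h
    rw [← hrect a b h, hLΦ, hΨ, Finsupp.linearCombination_single, one_smul]
  · intro u hu hu0
    have hle : Submodule.span ℝ {g : H → ℝ | ∃ P ∈ e.measurableRectangles, g = P.indicator 1} ≤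
        LinearMap.range Φ := by
      refine Submodule.span_le.2 ?_
      rintro _ ⟨P, hP, rfl⟩
      rcases hP with rfl | ⟨a, b, h, rfl⟩
      · rw [Set.indicator_empty]
        exact Submodule.zero_mem _
      · exact ⟨_, hrect a b h⟩
    obtain ⟨v, rfl⟩ := hle hu
    rw [hLΦ]
    exact hpos v hu0

theorem indicator_mem_span (e : HilbertBasis ℕ ℝ H) {A : Set H} (hA : A ∈ e.rectangleRing) :
    A.indicator 1 ∈
      Submodule.span ℝ {g : H → ℝ | ∃ P ∈ e.measurableRectangles, g = P.indicator 1} := by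
  set V := Submodule.span ℝ {g : H → ℝ | ∃ P ∈ e.measurableRectangles, g = P.indicator 1} with hV
  have hmul : ∀ u ∈ V, ∀ w ∈ V, u * w ∈ V := by
    intro u hu w hw
    induction hu using Submodule.span_induction with
    | zero => rw [zero_mul]; exact V.zero_mem
    | add u u' _ _ h h' => rw [add_mul]; exact V.add_mem h h'
    | smul c u _ h => rw [smul_mul_assoc]; exact V.smul_mem c h
    | mem u hu =>
      induction hw using Submodule.span_induction with
      | zero => rw [mul_zero]; exact V.zero_mem
      | add w w' _ _ h h' => rw [mul_add]; exact V.add_mem h h'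
      | smul c w _ h => rw [mul_smul_comm]; exact V.smul_mem c h
      | mem w hw =>
        obtain ⟨P, hP, rfl⟩ := hu
        obtain ⟨Q, hQ, rfl⟩ := hw
        refine Submodule.subset_span ⟨P ∩ Q, e.inter_mem_measurableRectangles hP hQ, ?_⟩
        rw [Set.inter_indicator_one]
  have hdiff : ∀ s t : Set H, (s \ t).indicator (1 : H → ℝ) =
      s.indicator 1 - s.indicator 1 * t.indicator 1 := by
    intro s t
    ext x
    by_cases hs : x ∈ s <;> by_cases ht : x ∈ t <;> simp [hs, ht]
  have hunion : ∀ s t : Set H, (s ∪ t).indicator (1 : H → ℝ) =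
      s.indicator 1 + t.indicator 1 - s.indicator 1 * t.indicator 1 := by
    intro s t
    ext x
    by_cases hs : x ∈ s <;> by_cases ht : x ∈ t <;> simp [hs, ht]
  refine hA {A | A.indicator 1 ∈ V} ⟨⟨?_, ?_, ?_⟩, ?_⟩
  · simp only [Set.mem_ofPred_eq, Set.indicator_empty]
    exact V.zero_mem
  · intro s t hs ht
    simp only [Set.mem_ofPred_eq] at *
    rw [hunion]
    exact V.sub_mem (V.add_mem hs ht) (hmul _ hs _ ht)
  · intro s t hs ht
    simp only [Set.mem_ofPred_eq] at *
    rw [hdiff]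
    exact V.sub_mem hs (hmul _ hs _ ht)
  · intro P hP
    exact Submodule.subset_span ⟨P, hP, rfl⟩

/-- `m` is a finitely additive nonnegative measure on the ring `r_e` whose value on a nonempty
measurable rectangle is the product of the lengths of its edges. -/
structure IsRectangleMeasure (e : HilbertBasis ℕ ℝ H) (m : AddContent ℝ e.rectangleRing) :
    Prop where
  nonneg : ∀ A ∈ e.rectangleRing, 0 ≤ m A
  rectangle : ∀ a b, e.IsMeasurableEdges a b → m (e.rectangle a b) = edgeProduct a b

theorem exists_isRectangleMeasure (e : HilbertBasis ℕ ℝ H) :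
    ∃ m : AddContent ℝ e.rectangleRing, e.IsRectangleMeasure m := by
  obtain ⟨L, hL, hL0⟩ := e.exists_functional
  refine ⟨e.isSetRing_rectangleRing.addContent_of_union (fun A => L (A.indicator 1)) ?_ ?_, ?_, ?_⟩
  · rw [Set.indicator_empty]
    exact map_zero L
  · intro s t _ _ hst
    rw [Set.indicator_union_of_disjoint hst, ← map_add]
    rfl
  · intro A hA
    exact hL0 _ (e.indicator_mem_span hA) fun x => Set.indicator_nonneg (fun _ _ => zero_le_one) x
  · intro a b h
    exact hL a b h

/-- The measure `λ_e` on the ring `r_e`: the unique additive extension of the volume of rectangles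
(uniqueness is proved in `eq_ringMeasure` below). -/
def ringMeasure (e : HilbertBasis ℕ ℝ H) : AddContent ℝ e.rectangleRing :=
  e.exists_isRectangleMeasure.choose

theorem isRectangleMeasure_ringMeasure (e : HilbertBasis ℕ ℝ H) :
    e.IsRectangleMeasure e.ringMeasure := e.exists_isRectangleMeasure.choose_spec

/-- The smallest collection containing `K_e` and stable under disjoint unions and proper
differences. -/
inductive DynkinGen (e : HilbertBasis ℕ ℝ H) : Set H → Prop
  | basic (P : Set H) (hP : P ∈ e.measurableRectangles) : DynkinGen e P
  | union (A B : Set H) (hA : DynkinGen e A) (hB : DynkinGen e B) (h : Disjoint A B) :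
      DynkinGen e (A ∪ B)
  | diff (A B : Set H) (hA : DynkinGen e A) (hB : DynkinGen e B) (h : B ⊆ A) :
      DynkinGen e (A \ B)

theorem DynkinGen.inter {e : HilbertBasis ℕ ℝ H} {A B : Set H} (hA : e.DynkinGen A)
    (hB : e.DynkinGen B) : e.DynkinGen (A ∩ B) := by
  induction hA with
  | union A A' _ _ h ih ih' =>
    rw [Set.union_inter_distrib_right]
    exact .union _ _ ih ih' (h.mono Set.inter_subset_left Set.inter_subset_left)
  | diff A A' _ _ h ih ih' =>
    have : (A \ A') ∩ B = (A ∩ B) \ (A' ∩ B) := by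
      ext x; simp only [Set.mem_inter_iff, Set.mem_sdiff]; tauto
    rw [this]
    exact .diff _ _ ih ih' (Set.inter_subset_inter_left _ h)
  | basic P hP =>
    induction hB with
    | basic Q hQ => exact .basic _ (e.inter_mem_measurableRectangles hP hQ)
    | union B B' _ _ h ih ih' =>
      rw [Set.inter_union_distrib_left]
      exact .union _ _ ih ih' (h.mono Set.inter_subset_right Set.inter_subset_right)
    | diff B B' _ _ h ih ih' =>
      have : P ∩ (B \ B') = (P ∩ B) \ (P ∩ B') := by
        ext x; simp only [Set.mem_inter_iff, Set.mem_sdiff]; tauto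
      rw [this]
      exact .diff _ _ ih ih' (Set.inter_subset_inter_right _ h)

theorem dynkinGen_of_mem_rectangleRing (e : HilbertBasis ℕ ℝ H) {A : Set H}
    (hA : A ∈ e.rectangleRing) : e.DynkinGen A := by
  have hd : ∀ s t : Set H, e.DynkinGen s → e.DynkinGen t → e.DynkinGen (s \ t) := by
    intro s t hs ht
    rw [← Set.sdiff_self_inter]
    exact .diff _ _ hs (hs.inter ht) Set.inter_subset_left
  refine hA {A | e.DynkinGen A} ⟨⟨.basic _ (Or.inl rfl), ?_, hd⟩, fun P hP => .basic P hP⟩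
  intro s t hs ht
  have : s ∪ t = (s \ t) ∪ t := by simp
  rw [this]
  exact .union _ _ (hd s t hs ht) ht Set.disjoint_sdiff_left

/-- Uniqueness of the extension: every finitely additive function on `r_e` with the prescribed
values on measurable rectangles agrees with `λ_e`. -/
theorem eq_ringMeasure (e : HilbertBasis ℕ ℝ H) (m : AddContent ℝ e.rectangleRing)
    (hm : ∀ a b, e.IsMeasurableEdges a b → m (e.rectangle a b) = edgeProduct a b)
    {A : Set H} (hA : A ∈ e.rectangleRing) : m A = e.ringMeasure A := by
  have hR := e.isSetRing_rectangleRing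
  suffices A ∈ e.rectangleRing ∧ m A = e.ringMeasure A from this.2
  have hD := e.dynkinGen_of_mem_rectangleRing hA
  clear hA
  induction hD with
  | basic P hP =>
    refine ⟨e.measurableRectangles_subset hP, ?_⟩
    rcases hP with rfl | ⟨a, b, h, rfl⟩
    · simp
    · rw [hm a b h, e.isRectangleMeasure_ringMeasure.rectangle a b h]
  | union A B _ _ h ih ih' =>
    exact ⟨hR.union_mem ih.1 ih'.1, by
      rw [addContent_union hR ih.1 ih'.1 h, addContent_union hR ih.1 ih'.1 h, ih.2, ih'.2]⟩
  | diff A B _ _ h ih ih' =>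
    have hAB := hR.sdiff_mem ih.1 ih'.1
    refine ⟨hAB, ?_⟩
    have h1 := addContent_union (m := m) hR hAB ih'.1 Set.disjoint_sdiff_left
    have h2 := addContent_union (m := e.ringMeasure) hR hAB ih'.1 Set.disjoint_sdiff_left
    rw [Set.sdiff_union_of_subset h] at h1 h2
    linarith [ih.2, ih'.2]

/-- The collection `R_e` (a ring of sets) of `λ_e`-measurable sets. -/
def measurableRing (e : HilbertBasis ℕ ℝ H) : Set (Set H) :=
  {A | ∀ ε : ℝ, 0 < ε → ∃ A₁ ∈ e.rectangleRing, ∃ A₂ ∈ e.rectangleRing,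
    A₁ ⊆ A ∧ A ⊆ A₂ ∧ e.ringMeasure (A₂ \ A₁) < ε}

/-- The measure `λ_e` on `R_e`: the infimum of the measures of the sets of `r_e` containing `A`.
It is meant for `A ∈ R_e`, where the infimum is over a nonempty set of nonnegative numbers. -/
def measure (e : HilbertBasis ℕ ℝ H) (A : Set H) : ℝ :=
  sInf {r | ∃ B ∈ e.rectangleRing, A ⊆ B ∧ r = e.ringMeasure B}

/-- On the ring `r_e` the extended measure agrees with the original one. -/
theorem measure_eq_ringMeasure (e : HilbertBasis ℕ ℝ H) {A : Set H} (hA : A ∈ e.rectangleRing) :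
    e.measure A = e.ringMeasure A := by
  have hR := e.isSetRing_rectangleRing
  refine IsLeast.csInf_eq ⟨⟨A, hA, subset_rfl, rfl⟩, ?_⟩
  rintro _ ⟨B, hB, hAB, rfl⟩
  have hBA := hR.sdiff_mem hB hA
  have h1 := addContent_union (m := e.ringMeasure) hR hBA hA Set.disjoint_sdiff_left
  rw [Set.sdiff_union_of_subset hAB] at h1
  linarith [e.isRectangleMeasure_ringMeasure.nonneg _ hBA]

/-- `e` is near to `f`: the infinite product over `j` of the `ℓ¹` norms of the columns
`i ↦ (e i, f j)` of the transition matrix converges to a finite limit. The norms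
are extended reals in `[1, ∞]`, so the limit of the partial products always exists in `[1, ∞]`. -/
def IsNear (e f : HilbertBasis ℕ ℝ H) : Prop :=
  ∃ L : ℝ≥0∞, L < ∞ ∧
    Tendsto (fun n => ∏ j ∈ Finset.range n, ∑' i, ENNReal.ofReal |inner ℝ (e i) (f j)|)
      atTop (𝓝 L)

end HilbertBasis

end

noncomputable section

open MeasureTheory Filter Topology
open scoped ENNReal

theorem card_le_of_disjoint_matching {t : ℕ → ℕ → ℝ} (hrow : ∀ i, HasSum (fun j => t i j ^ 2) 1)
    (hcol : ∀ j, HasSum (fun i => t i j ^ 2) 1) {N : ℕ} {g : ℕ → ℕ}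
    (hd : Summable fun k => 1 - t (g k) (k + N) ^ 2) (hd1 : ∑' k, (1 - t (g k) (k + N) ^ 2) < 1)
    (S : Finset ℕ) (hS : ∀ k, g k ∉ S) : S.card ≤ N := by
  have h1 : HasSum (fun j => ∑ i ∈ S, t i j ^ 2) (S.card : ℝ) := by
    simpa using hasSum_sum (s := S) fun i _ => hrow i
  have h2 := h1.summable.sum_add_tsum_nat_add N
  rw [h1.tsum_eq] at h2
  have h3 : ∑ j ∈ Finset.range N, ∑ i ∈ S, t i j ^ 2 ≤ N := by
    have : ∑ j ∈ Finset.range N, ∑ i ∈ S, t i j ^ 2 ≤ ∑ j ∈ Finset.range N, (1 : ℝ) :=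
      Finset.sum_le_sum fun j _ => sum_le_hasSum _ (fun _ _ => sq_nonneg _) (hcol j)
    simpa using this
  have h4 : ∑' k, ∑ i ∈ S, t i (k + N) ^ 2 ≤ ∑' k, (1 - t (g k) (k + N) ^ 2) := by
    refine Summable.tsum_le_tsum (fun k => ?_) ((summable_nat_add_iff N).2 h1.summable) hd
    have := sum_le_hasSum (insert (g k) S) (fun _ _ => sq_nonneg _) (hcol (k + N))
    rw [Finset.sum_insert (hS k)] at this
    linarith
  have h5 : (S.card : ℝ) < N + 1 := by linarith
  exact Nat.lt_succ_iff.1 (by exact_mod_cast h5)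

theorem le_card_of_compl_matching {t : ℕ → ℕ → ℝ} (hrow : ∀ i, HasSum (fun j => t i j ^ 2) 1)
    (hcol : ∀ j, HasSum (fun i => t i j ^ 2) 1) {N : ℕ} {g : ℕ → ℕ} (hg : Function.Injective g)
    (hd : Summable fun k => 1 - t (g k) (k + N) ^ 2) (hd1 : ∑' k, (1 - t (g k) (k + N) ^ 2) < 1)
    (S : Finset ℕ) (hS : (S : Set ℕ) = (Set.range g)ᶜ) : N ≤ S.card := by
  set q : ℕ → ℝ := fun i => ∑ j ∈ Finset.range N, t i j ^ 2 with hq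
  have h1 : HasSum q (N : ℝ) := by
    simpa using hasSum_sum (s := Finset.range N) fun j _ => hcol j
  have h2 := h1.summable.tsum_subtype_add_tsum_subtype_compl (Set.range g)
  rw [h1.tsum_eq, tsum_range q hg, ← hS, Finset.tsum_subtype' S q] at h2
  have h3 : ∑ i ∈ S, q i ≤ S.card := by
    have : ∑ i ∈ S, q i ≤ ∑ i ∈ S, (1 : ℝ) :=
      Finset.sum_le_sum fun i _ => sum_le_hasSum _ (fun _ _ => sq_nonneg _) (hrow i)
    simpa using this
  have h4 : ∑' k, q (g k) ≤ ∑' k, (1 - t (g k) (k + N) ^ 2) := by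
    refine Summable.tsum_le_tsum (fun k => ?_) (h1.summable.comp_injective hg) hd
    have hk : k + N ∉ Finset.range N := by simp
    have := sum_le_hasSum (insert (k + N) (Finset.range N)) (fun _ _ => sq_nonneg _) (hrow (g k))
    rw [Finset.sum_insert hk] at this
    simp only [hq]
    linarith
  have h5 : (N : ℝ) < S.card + 1 := by linarith
  exact Nat.lt_succ_iff.1 (by exact_mod_cast h5)

theorem exists_perm_extending {N : ℕ} {g : ℕ → ℕ} (hg : Function.Injective g) (S : Finset ℕ)
    (hS : (S : Set ℕ) = (Set.range g)ᶜ) (hcard : S.card = N) :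
    ∃ τ : Equiv.Perm ℕ, ∀ k, τ (k + N) = g k := by
  have hS' : ∀ i, i ∈ S ↔ ∀ k, g k ≠ i := fun i => by
    rw [← Finset.mem_coe, hS]
    simp
  set c : Fin N ≃ S := (S.equivFinOfCardEq hcard).symm
  set τ : ℕ → ℕ := fun j => if h : j < N then c ⟨j, h⟩ else g (j - N) with hτ
  have hτ1 : ∀ j (h : j < N), τ j = c ⟨j, h⟩ := fun j h => dif_pos h
  have hτ2 : ∀ j, N ≤ j → τ j = g (j - N) := fun j h => dif_neg (not_lt.2 h)
  have hbij : Function.Bijective τ := by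
    constructor
    · intro j j' hjj
      rcases lt_or_ge j N with h | h <;> rcases lt_or_ge j' N with h' | h'
      · rw [hτ1 j h, hτ1 j' h'] at hjj
        simpa using c.injective (Subtype.ext hjj)
      · rw [hτ1 j h, hτ2 j' h'] at hjj
        exact absurd hjj.symm ((hS' _).1 (c ⟨j, h⟩).2 _)
      · rw [hτ2 j h, hτ1 j' h'] at hjj
        exact absurd hjj ((hS' _).1 (c ⟨j', h'⟩).2 _)
      · rw [hτ2 j h, hτ2 j' h'] at hjj
        have := hg hjj
        omega
    · intro i
      by_cases hi : i ∈ S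
      · refine ⟨c.symm ⟨i, hi⟩, ?_⟩
        rw [hτ1 _ (c.symm ⟨i, hi⟩).2, Fin.eta, c.apply_symm_apply]
      · rw [hS'] at hi
        push Not at hi
        obtain ⟨k, rfl⟩ := hi
        exact ⟨k + N, by rw [hτ2 _ (Nat.le_add_left _ _), Nat.add_sub_cancel]⟩
  refine ⟨Equiv.ofBijective τ hbij, fun k => ?_⟩
  rw [Equiv.ofBijective_apply, hτ2 _ (Nat.le_add_left _ _), Nat.add_sub_cancel]

/-- A partial matching of the columns of a matrix with normalised rows and columns that carries
almost all of the mass extends to a permutation. -/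
theorem exists_perm_eventuallyEq {t : ℕ → ℕ → ℝ} (hrow : ∀ i, HasSum (fun j => t i j ^ 2) 1)
    (hcol : ∀ j, HasSum (fun i => t i j ^ 2) 1) {σ : ℕ → ℕ}
    (hσ : Summable fun j => 1 - t (σ j) j ^ 2) :
    ∃ τ : Equiv.Perm ℕ, ∀ᶠ j in atTop, τ j = σ j := by
  have hd0 : ∀ i j, 0 ≤ 1 - t i j ^ 2 := fun i j =>
    sub_nonneg.2 (le_hasSum (hrow i) j fun _ _ => sq_nonneg _)
  obtain ⟨N, hN⟩ := ((tendsto_sum_nat_add fun j => 1 - t (σ j) j ^ 2).eventually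
    (gt_mem_nhds zero_lt_one)).exists
  have hds : Summable fun k => 1 - t (σ (k + N)) (k + N) ^ 2 := (summable_nat_add_iff N).2 hσ
  have hginj : Function.Injective fun k => σ (k + N) := by
    intro k k' hkk
    by_contra hne
    have h1 : ∑ j ∈ ({k + N, k' + N} : Finset ℕ), t (σ (k + N)) j ^ 2 ≤ 1 :=
      sum_le_hasSum _ (fun _ _ => sq_nonneg _) (hrow _)
    have h2 := hds.sum_le_tsum {k, k'} fun _ _ => hd0 _ _
    rw [Finset.sum_pair (by omega)] at h1
    rw [Finset.sum_pair hne] at h2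
    dsimp only at hkk
    rw [← hkk] at h2
    linarith
  have hle := card_le_of_disjoint_matching hrow hcol (g := fun k => σ (k + N)) hds hN
  have hfin : (Set.range fun k => σ (k + N))ᶜ.Finite := by
    by_contra hinf
    obtain ⟨S, hS, hS'⟩ := (show (Set.range fun k => σ (k + N))ᶜ.Infinite from
      hinf).exists_subset_card_eq (N + 1)
    have := hle S fun k hk => hS hk ⟨k, rfl⟩
    omega
  have hcard : hfin.toFinset.card = N :=
    le_antisymm (hle _ fun k => by simp)
      (le_card_of_compl_matching hrow hcol hginj hds hN _ hfin.coe_toFinset)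
  obtain ⟨τ, hτ⟩ := exists_perm_extending hginj _ hfin.coe_toFinset hcard
  refine ⟨τ, ?_⟩
  filter_upwards [eventually_ge_atTop N] with j hj
  have := hτ (j - N)
  rwa [Nat.sub_add_cancel hj] at this

/-- A column of unit `ℓ²` norm whose `ℓ¹` norm is `1 + u` is within `3u` of a signed unit vector. -/
theorem exists_signed_unit_near {v : ℕ → ℝ} (h2 : HasSum (fun i => v i ^ 2) 1)
    (h1 : Summable fun i => |v i|) :
    ∃ k, ∃ s : ℝ, |s| = 1 ∧ 1 - v k ^ 2 ≤ 2 * (∑' i, |v i| - 1) ∧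
      ∑' i, |v i - if i = k then s else 0| ≤ 3 * (∑' i, |v i| - 1) := by
  have hle1 : ∀ i, |v i| ≤ 1 := fun i => by
    rw [← sq_le_one_iff_abs_le_one]
    exact le_hasSum h2 i fun _ _ => sq_nonneg _
  obtain ⟨k, hk⟩ : ∃ k, ∀ i, |v i| ≤ |v k| := by
    obtain ⟨i₀, hi₀⟩ : ∃ i, v i ≠ 0 := by
      by_contra! h
      have := h2.tsum_eq
      simp [h] at this
    obtain ⟨n, hn⟩ := eventually_atTop.1
      (h1.tendsto_atTop_zero.eventually (gt_mem_nhds (abs_pos.2 hi₀)))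
    obtain ⟨k, -, hk⟩ := Finset.exists_max_image (insert i₀ (Finset.range n)) (fun i => |v i|)
      ⟨i₀, Finset.mem_insert_self _ _⟩
    refine ⟨k, fun i => ?_⟩
    rcases lt_or_ge i n with h | h
    · exact hk i (Finset.mem_insert_of_mem (Finset.mem_range.2 h))
    · exact (hn i h).le.trans (hk i₀ (Finset.mem_insert_self _ _))
  set S := ∑' i, |v i| with hS
  have hmS : 1 ≤ |v k| * S := by
    rw [← h2.tsum_eq, hS, ← tsum_mul_left]
    refine h2.summable.tsum_le_tsum (fun i => ?_) (h1.mul_left _)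
    rw [← sq_abs, sq]
    exact mul_le_mul_of_nonneg_right (hk i) (abs_nonneg _)
  have hm0 := abs_nonneg (v k)
  have hm1 := hle1 k
  have hS0 : 0 ≤ S := tsum_nonneg fun _ => abs_nonneg _
  have hS1 : 1 ≤ S := by nlinarith
  have hmu : 2 - S ≤ |v k| := by nlinarith [sq_nonneg (S - 1)]
  obtain ⟨s, hs, hsv⟩ : ∃ s : ℝ, |s| = 1 ∧ |v k - s| = 1 - |v k| := by
    rcases le_total 0 (v k) with h | h
    · refine ⟨1, abs_one, ?_⟩
      rw [abs_of_nonneg h, abs_of_nonpos (by rw [abs_of_nonneg h] at hm1; linarith)]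
      ring
    · refine ⟨-1, by simp, ?_⟩
      rw [abs_of_nonpos h, abs_of_nonneg (by rw [abs_of_nonpos h] at hm1; linarith)]
      ring
  refine ⟨k, s, hs, ?_, ?_⟩
  · rw [← sq_abs]
    nlinarith
  · have h3 : HasSum (fun i => if i = k then 1 - 2 * |v k| else 0) (1 - 2 * |v k|) :=
      hasSum_ite_eq k _
    have h4 := h1.hasSum.add h3
    have h5 : (fun i => |v i - if i = k then s else 0|) =
        fun i => |v i| + if i = k then 1 - 2 * |v k| else 0 := by
      ext i
      split_ifs with h
      · rw [h, hsv]; ring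
      · simp
    rw [h5, h4.tsum_eq]
    linarith

theorem sum_sub_one_le_prod {s : ℕ → ℝ} (hs : ∀ j, 1 ≤ s j) (n : ℕ) :
    ∑ j ∈ Finset.range n, (s j - 1) + 1 ≤ ∏ j ∈ Finset.range n, s j := by
  induction n with
  | zero => simp
  | succ n ih =>
    rw [Finset.sum_range_succ, Finset.prod_range_succ]
    have h0 : 0 ≤ ∑ j ∈ Finset.range n, (s j - 1) :=
      Finset.sum_nonneg fun j _ => sub_nonneg.2 (hs j)
    nlinarith [hs n]

namespace HilbertBasis

variable {H : Type*} [NormedAddCommGroup H] [InnerProductSpace ℝ H]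

theorem hasSum_inner_sq (e : HilbertBasis ℕ ℝ H) (x : H) :
    HasSum (fun i => inner ℝ (e i) x ^ 2) (‖x‖ ^ 2) := by
  rw [← real_inner_self_eq_norm_sq]
  refine (e.hasSum_inner_mul_inner x x).congr_fun fun i => ?_
  rw [real_inner_comm x (e i), sq]

theorem hasSum_inner_basis_sq (e f : HilbertBasis ℕ ℝ H) (j : ℕ) :
    HasSum (fun i => inner ℝ (e i) (f j) ^ 2) 1 := by
  simpa [f.orthonormal.1 j] using e.hasSum_inner_sq (f j)

theorem IsNear.summable_column {e f : HilbertBasis ℕ ℝ H} (h : e.IsNear f) :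
    (∀ j, Summable fun i => |inner ℝ (e i) (f j)|) ∧
      Summable fun j => ∑' i, |inner ℝ (e i) (f j)| - 1 := by
  obtain ⟨L, hL, hlim⟩ := h
  set S : ℕ → ℝ≥0∞ := fun j => ∑' i, ENNReal.ofReal |inner ℝ (e i) (f j)| with hS
  have hS1 : ∀ j, 1 ≤ S j := by
    intro j
    have h2 := e.hasSum_inner_basis_sq f j
    have : (1 : ℝ≥0∞) = ∑' i, ENNReal.ofReal (inner ℝ (e i) (f j) ^ 2) := by
      rw [← ENNReal.ofReal_tsum_of_nonneg (fun _ => sq_nonneg _) h2.summable, h2.tsum_eq,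
        ENNReal.ofReal_one]
    rw [this]
    refine ENNReal.tsum_le_tsum fun i => ENNReal.ofReal_le_ofReal ?_
    have h3 : inner ℝ (e i) (f j) ^ 2 ≤ 1 := le_hasSum h2 i fun _ _ => sq_nonneg _
    have h4 := (sq_le_one_iff_abs_le_one _).1 h3
    rw [← sq_abs]
    nlinarith [abs_nonneg (inner ℝ (e i) (f j))]
  have hmono : Monotone fun n => ∏ j ∈ Finset.range n, S j :=
    monotone_nat_of_le_succ fun n => by
      rw [Finset.prod_range_succ]
      exact le_mul_of_one_le_right' (hS1 n)
  have hle : ∀ n, ∏ j ∈ Finset.range n, S j ≤ L := fun n => hmono.ge_of_tendsto hlim n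
  have hfin : ∀ j, S j ≠ ∞ := by
    intro j
    refine ne_top_of_le_ne_top hL.ne ((?_ : S j ≤ _).trans (hle (j + 1)))
    rw [Finset.prod_range_succ]
    refine le_mul_of_one_le_left' ?_
    simpa using hmono (Nat.zero_le j)
  have hsum : ∀ j, Summable fun i => |inner ℝ (e i) (f j)| := fun j => by
    have := ENNReal.summable_toReal (hfin j)
    simpa using this
  have hreal : ∀ j, (S j).toReal = ∑' i, |inner ℝ (e i) (f j)| := fun j => by
    rw [hS]
    dsimp only
    rw [← ENNReal.ofReal_tsum_of_nonneg (fun _ => abs_nonneg _) (hsum j),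
      ENNReal.toReal_ofReal (tsum_nonneg fun _ => abs_nonneg _)]
  have hreal1 : ∀ j, 1 ≤ (S j).toReal := fun j => by
    simpa using ENNReal.toReal_mono (hfin j) (hS1 j)
  refine ⟨hsum, ?_⟩
  simp_rw [← hreal]
  refine summable_of_sum_range_le (c := L.toReal) (fun j => sub_nonneg.2 (hreal1 j)) fun n => ?_
  have h1 := sum_sub_one_le_prod hreal1 n
  have h2 := ENNReal.toReal_mono hL.ne (hle n)
  rw [ENNReal.toReal_prod] at h2
  linarith

/-- After a permutation the transition matrix differs from a diagonal matrix of signs by a matrix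
with absolutely summable entries. -/
def IsMatched (e f : HilbertBasis ℕ ℝ H) : Prop :=
  ∃ (π : Equiv.Perm ℕ) (s : ℕ → ℝ), (∀ j, |s j| = 1) ∧
    Summable fun p : ℕ × ℕ => |inner ℝ (e p.1) (f (π p.2)) - if p.1 = p.2 then s p.2 else 0|

theorem IsMatched.symm {e f : HilbertBasis ℕ ℝ H} (h : e.IsMatched f) : f.IsMatched e := by
  obtain ⟨π, s, hs, hsum⟩ := h
  refine ⟨π⁻¹, fun j => s (π⁻¹ j), fun j => hs _, ?_⟩
  have := hsum.comp_injective
    (((Equiv.prodComm ℕ ℕ).trans (Equiv.prodCongr π⁻¹ π⁻¹)).injective)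
  refine this.congr fun p => ?_
  have hπ : ∀ k, π (π⁻¹ k) = k := π.apply_symm_apply
  have h1 : π⁻¹ p.2 = π⁻¹ p.1 ↔ p.1 = p.2 := by rw [π⁻¹.injective.eq_iff, eq_comm]
  simp only [Function.comp, Equiv.trans_apply, Equiv.prodComm_apply, Equiv.prodCongr_apply,
    Prod.map, Prod.fst_swap, Prod.snd_swap, hπ, h1]
  rw [real_inner_comm]
  split_ifs with h2
  · rw [h2]
  · rfl

theorem IsNear.isMatched {e f : HilbertBasis ℕ ℝ H} (h : e.IsNear f) : e.IsMatched f := by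
  obtain ⟨hc, hu⟩ := h.summable_column
  choose σ s hs h1 h2 using fun j => exists_signed_unit_near (e.hasSum_inner_basis_sq f j) (hc j)
  have hrow : ∀ i, HasSum (fun j => inner ℝ (e i) (f j) ^ 2) 1 := fun i => by
    simpa only [real_inner_comm] using f.hasSum_inner_basis_sq e i
  have hle1 : ∀ i j, inner ℝ (e i) (f j) ^ 2 ≤ 1 := fun i j =>
    le_hasSum (hrow i) j fun _ _ => sq_nonneg _
  obtain ⟨τ, hτ⟩ := exists_perm_eventuallyEq hrow (e.hasSum_inner_basis_sq f) (σ := σ)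
    (Summable.of_nonneg_of_le (fun j => sub_nonneg.2 (hle1 _ _)) h1 (hu.mul_left 2))
  have hcol : ∀ j, Summable fun i => |inner ℝ (e i) (f j) - if i = τ j then s j else 0| := by
    intro j
    refine Summable.of_nonneg_of_le (fun _ => abs_nonneg _) (fun i => abs_sub _ _)
      ((hc j).add ?_)
    refine (hasSum_ite_eq (τ j) |s j|).summable.congr fun i => ?_
    split_ifs <;> simp
  have hsum : Summable fun p : ℕ × ℕ =>
      |inner ℝ (e p.2) (f p.1) - if p.2 = τ p.1 then s p.1 else 0| := by
    rw [summable_prod_of_nonneg fun _ => abs_nonneg _]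
    refine ⟨hcol, ?_⟩
    refine Summable.of_norm_bounded_eventually_nat (hu.mul_left 3) ?_
    filter_upwards [hτ] with j hj
    rw [Real.norm_of_nonneg (tsum_nonneg fun _ => abs_nonneg _)]
    simpa only [hj] using h2 j
  refine ⟨τ⁻¹, fun j => s (τ⁻¹ j), fun j => hs _, ?_⟩
  have := hsum.comp_injective
    (((Equiv.prodComm ℕ ℕ).trans (Equiv.prodCongr τ⁻¹ (Equiv.refl ℕ))).injective)
  refine this.congr fun p => ?_
  simp

end HilbertBasis

theorem edgeProduct_eq_exp {a b : ℕ → ℝ} (h : Summable fun j => Real.log (b j - a j)) :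
    edgeProduct a b = Real.exp (∑' j, Real.log (b j - a j)) := by
  rw [edgeProduct, if_pos h]

theorem edgeProduct_eq_zero {a b : ℕ → ℝ} (h : ¬ Summable fun j => Real.log (b j - a j)) :
    edgeProduct a b = 0 := by
  rw [edgeProduct, if_neg h]

theorem abs_log_one_add_le {y : ℝ} (hy : |y| ≤ 1 / 2) : |Real.log (1 + y)| ≤ 2 * |y| := by
  obtain ⟨h1, h2⟩ := abs_le.1 hy
  have hpos : 0 < 1 + y := by linarith
  have h3 := Real.log_le_sub_one_of_pos hpos
  have h4 := Real.one_sub_inv_le_log_of_pos hpos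
  have h5 : -(2 * |y|) ≤ 1 - (1 + y)⁻¹ := by
    have : 1 - (1 + y)⁻¹ = y / (1 + y) := by field_simp; ring
    rw [this, le_div_iff₀ hpos]
    rcases le_total 0 y with h | h
    · rw [abs_of_nonneg h]; nlinarith
    · rw [abs_of_nonpos h]; nlinarith
  rw [abs_le]
  constructor
  · linarith
  · linarith [le_abs_self y, abs_nonneg y]

theorem abs_log_add_sub_log_le {l w m : ℝ} (hm : 0 < m) (hml : m ≤ l) (hw : 2 * |w| ≤ m) :
    |Real.log (l + w) - Real.log l| ≤ 2 * |w| / m := by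
  have hl := hm.trans_le hml
  have hwl : |w / l| ≤ |w| / m := by
    rw [abs_div, abs_of_pos hl]
    exact div_le_div_of_nonneg_left (abs_nonneg _) hm hml
  have hhalf : |w| / m ≤ 1 / 2 := by
    rw [div_le_iff₀ hm]; linarith
  have h := abs_log_one_add_le (hwl.trans hhalf)
  have h1 : 0 < 1 + w / l := by linarith [(abs_le.1 (hwl.trans hhalf)).1]
  have h2 : l + w = l * (1 + w / l) := by field_simp
  rw [h2, Real.log_mul hl.ne' h1.ne', add_sub_cancel_left]
  calc _ ≤ 2 * |w / l| := h
    _ ≤ 2 * (|w| / m) := by linarith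
    _ = 2 * |w| / m := by ring

/-- Perturbing the lengths `l` by a small summable sequence `w` changes the infinite product
by a factor close to one. -/
theorem exp_tsum_log_perturb {l w : ℕ → ℝ} {m : ℝ} (hm : 0 < m) (hml : ∀ j, m ≤ l j)
    (hl : Summable fun j => Real.log (l j)) (hw : Summable fun j => |w j|)
    (hwm : 2 * ∑' j, |w j| ≤ m) :
    (∀ j, 0 < l j + w j) ∧ (Summable fun j => Real.log (l j + w j)) ∧
      Real.exp (∑' j, Real.log (l j + w j)) ≤
        Real.exp (∑' j, Real.log (l j)) * Real.exp (2 * (∑' j, |w j|) / m) ∧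
      Real.exp (∑' j, Real.log (l j)) * Real.exp (-(2 * (∑' j, |w j|) / m)) ≤
        Real.exp (∑' j, Real.log (l j + w j)) := by
  have hwj : ∀ j, |w j| ≤ ∑' j, |w j| := fun j => hw.le_tsum j fun _ _ => abs_nonneg _
  have hd : ∀ j, |Real.log (l j + w j) - Real.log (l j)| ≤ 2 * |w j| / m := fun j =>
    abs_log_add_sub_log_le hm (hml j) (by linarith [hwj j])
  have hds : Summable fun j => 2 * |w j| / m := (hw.mul_left 2).div_const m
  have hdiff : Summable fun j => Real.log (l j + w j) - Real.log (l j) :=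
    Summable.of_norm_bounded hds hd
  have hs : Summable fun j => Real.log (l j + w j) := (hdiff.add hl).congr fun j => by ring
  have habs : |∑' j, (Real.log (l j + w j) - Real.log (l j))| ≤ 2 * (∑' j, |w j|) / m := by
    rw [← tsum_mul_left, ← tsum_div_const]
    exact tsum_of_norm_bounded (f := fun j => Real.log (l j + w j) - Real.log (l j)) hds.hasSum hd
  rw [hs.tsum_sub hl, abs_le] at habs
  refine ⟨fun j => ?_, hs, ?_, ?_⟩
  · linarith [hwj j, hml j, (abs_le.1 (le_refl |w j|)).1]
  · rw [← Real.exp_add]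
    exact Real.exp_le_exp.2 (by linarith [habs.2])
  · rw [← Real.exp_add]
    exact Real.exp_le_exp.2 (by linarith [habs.1])

theorem one_sub_sum_le_prod {ι : Type*} (s : Finset ι) {μ : ι → ℝ} (h0 : ∀ i, 0 ≤ μ i)
    (h1 : ∀ i, μ i ≤ 1) : 1 - ∑ i ∈ s, (1 - μ i) ≤ ∏ i ∈ s, μ i := by
  classical
  induction s using Finset.induction_on with
  | empty => simp
  | insert i s hi ih =>
    rw [Finset.sum_insert hi, Finset.prod_insert hi]
    have := Finset.prod_le_one (s := s) (fun i _ => h0 i) (fun i _ => h1 i)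
    nlinarith [h0 i, h1 i]

open Matrix in
/-- The determinant of a contraction whose columns are almost normalised is close to `±1`. -/
theorem det_sq_bounds {n : ℕ} (T : Matrix (Fin n) (Fin n) ℝ)
    (hT : ∀ v : Fin n → ℝ, ∑ i, (T *ᵥ v) i ^ 2 ≤ ∑ j, v j ^ 2) :
    1 - ∑ j, (1 - ∑ i, T i j ^ 2) ≤ T.det ^ 2 ∧ T.det ^ 2 ≤ 1 := by
  have hP : (Tᵀ * T).PosSemidef := by
    have := Matrix.posSemidef_conjTranspose_mul_self T
    rwa [Matrix.conjTranspose_eq_transpose_of_trivial] at this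
  have hdet : T.det ^ 2 = ∏ i, hP.1.eigenvalues i := by
    have := hP.1.det_eq_prod_eigenvalues
    rw [Matrix.det_mul, Matrix.det_transpose] at this
    rw [sq, this]
    rfl
  have htr : ∑ j, ∑ i, T i j ^ 2 = ∑ i, hP.1.eigenvalues i := by
    have := hP.1.trace_eq_sum_eigenvalues
    simp only [Matrix.trace, Matrix.diag, Matrix.mul_apply, Matrix.transpose_apply] at this
    calc _ = ∑ j, ∑ i, T i j * T i j := by simp only [sq]
      _ = _ := this
  have h0 : ∀ i, 0 ≤ hP.1.eigenvalues i := hP.eigenvalues_nonneg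
  have h1 : ∀ i, hP.1.eigenvalues i ≤ 1 := by
    intro i
    rw [hP.1.eigenvalues_eq]
    set v : Fin n → ℝ := ⇑(hP.1.eigenvectorBasis i) with hv
    have hn : ∑ j, v j ^ 2 = 1 := by
      have := hP.1.eigenvectorBasis.orthonormal.1 i
      have h2 := EuclideanSpace.real_norm_sq_eq (hP.1.eigenvectorBasis i)
      rw [this] at h2
      simpa using h2.symm
    have h3 := hT v
    rw [hn] at h3
    refine le_trans (le_of_eq ?_) h3
    have : star v ⬝ᵥ (Tᵀ * T) *ᵥ v = (T *ᵥ v) ⬝ᵥ (T *ᵥ v) := by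
      rw [← Matrix.mulVec_mulVec, Matrix.dotProduct_mulVec, Matrix.vecMul_transpose]
      rfl
    rw [this]
    simp [dotProduct, sq]
  rw [hdet]
  refine ⟨?_, Finset.prod_le_one (fun i _ => h0 i) fun i _ => h1 i⟩
  have := one_sub_sum_le_prod Finset.univ h0 h1
  rw [Finset.sum_sub_distrib] at this ⊢
  rwa [htr]

/-- The half-open cube of side `1 / m` with lower corner `k / m`. -/
def gridCube {n : ℕ} (m : ℕ) (k : Fin n → ℤ) : Set (Fin n → ℝ) :=
  Set.pi Set.univ fun i => Set.Ico (k i / m : ℝ) ((k i + 1) / m)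

theorem mem_gridCube_iff {n m : ℕ} (hm : 0 < m) {k : Fin n → ℤ} {u : Fin n → ℝ} :
    u ∈ gridCube m k ↔ ∀ i, ⌊(m : ℝ) * u i⌋ = k i := by
  have hm' : (0 : ℝ) < m := Nat.cast_pos.2 hm
  simp only [gridCube, Set.mem_univ_pi, Set.mem_Ico, Int.floor_eq_iff]
  refine forall_congr' fun i => ?_
  rw [div_le_iff₀ hm', lt_div_iff₀ hm', mul_comm]

theorem pairwise_disjoint_gridCube {n m : ℕ} (hm : 0 < m) :
    Pairwise (Function.onFun Disjoint (gridCube m : (Fin n → ℤ) → Set (Fin n → ℝ))) := by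
  intro k k' hkk
  refine Set.disjoint_left.2 fun u hu hu' => hkk (funext fun i => ?_)
  rw [← (mem_gridCube_iff hm).1 hu i, (mem_gridCube_iff hm).1 hu' i]

theorem exists_gridCube_cover {n : ℕ} {K : Set (Fin n → ℝ)} {C r : ℝ}
    (hK : ∀ u ∈ K, ∀ i, |u i| ≤ C) (hr : 0 < r) :
    ∃ m : ℕ, 0 < m ∧ ∃ G : Finset (Fin n → ℤ), K ⊆ (⋃ k ∈ G, gridCube m k) ∧
      ∀ u ∈ ⋃ k ∈ G, gridCube m k, ∃ w ∈ K, ∀ i, |u i - w i| ≤ r := by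
  classical
  obtain ⟨m', hm'⟩ := exists_nat_one_div_lt hr
  set m := m' + 1 with hmdef
  have hm : 0 < m := Nat.succ_pos _
  have hmr : (0 : ℝ) < m := Nat.cast_pos.2 hm
  have hmr' : 1 < r * m := by
    rw [div_lt_iff₀ (by positivity)] at hm'
    exact_mod_cast hm'
  set Z : ℤ := ⌈(m : ℝ) * C⌉ + 1 with hZ
  refine ⟨m, hm, (Finset.Icc (fun _ => -Z) (fun _ => Z)).filter fun k => (K ∩ gridCube m k).Nonempty,
    ?_, ?_⟩
  · intro u hu
    have hmem : u ∈ gridCube m fun i => ⌊(m : ℝ) * u i⌋ := (mem_gridCube_iff hm).2 fun _ => rfl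
    simp only [Set.mem_iUnion, exists_prop, Finset.mem_filter, Finset.mem_Icc, Pi.le_def]
    refine ⟨_, ⟨⟨fun i => ?_, fun i => ?_⟩, u, hu, hmem⟩, hmem⟩
    · rw [Int.le_floor]
      have h1 := (abs_le.1 (hK u hu i)).1
      have h2 := Int.le_ceil ((m : ℝ) * C)
      rw [hZ]
      push_cast
      nlinarith
    · have h1 := (abs_le.1 (hK u hu i)).2
      have h2 : (m : ℝ) * u i ≤ m * C := by nlinarith
      exact (Int.floor_le_floor h2).trans ((Int.floor_le_ceil _).trans (by omega))
  · intro u hu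
    simp only [Set.mem_iUnion, exists_prop, Finset.mem_filter] at hu
    obtain ⟨k, ⟨-, w, hwK, hwk⟩, huk⟩ := hu
    refine ⟨w, hwK, fun i => ?_⟩
    have h1 := huk i trivial
    have h2 := hwk i trivial
    simp only [Set.mem_Ico, div_le_iff₀ hmr, lt_div_iff₀ hmr] at h1 h2
    have h3 : |u i - w i| * m ≤ 1 := by
      rw [← Nat.abs_cast, ← abs_mul, abs_le]
      constructor <;> nlinarith [h1.1, h1.2, h2.1, h2.2]
    by_contra hc
    nlinarith [not_le.1 hc]

theorem volume_gridCube {n m : ℕ} (hm : 0 < m) (k : Fin n → ℤ) :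
    volume.real (gridCube m k) = ∏ i, (((k i : ℝ) + 1) / m - k i / m) := by
  have hmr : (0 : ℝ) < m := Nat.cast_pos.2 hm
  rw [gridCube, Measure.real, Real.volume_pi_Ico_toReal]
  intro i
  exact div_le_div_of_nonneg_right (by linarith) hmr.le

theorem measurableSet_gridCube {n m : ℕ} (k : Fin n → ℤ) : MeasurableSet (gridCube m k) :=
  MeasurableSet.univ_pi fun _ => measurableSet_Ico

theorem volume_gridCube_ne_top {n m : ℕ} (k : Fin n → ℤ) : volume (gridCube m k) ≠ ∞ := by
  rw [gridCube, Real.volume_pi_Ico]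
  exact (ENNReal.prod_lt_top fun j _ => ENNReal.ofReal_lt_top).ne

theorem volume_biUnion_gridCube {n m : ℕ} (hm : 0 < m) (G : Finset (Fin n → ℤ)) :
    volume.real (⋃ k ∈ G, gridCube m k) = ∑ k ∈ G, ∏ i, (((k i : ℝ) + 1) / m - k i / m) := by
  rw [measureReal_biUnion_finset (fun k _ k' _ h => pairwise_disjoint_gridCube hm h)
    (fun k _ => measurableSet_gridCube k) fun k _ => volume_gridCube_ne_top k]
  exact Finset.sum_congr rfl fun k _ => volume_gridCube hm k

theorem volume_biUnion_gridCube_ne_top {n m : ℕ} (G : Finset (Fin n → ℤ)) :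
    volume (⋃ k ∈ G, gridCube m k) ≠ ∞ :=
  (measure_biUnion_lt_top G.finite_toSet fun k _ => (volume_gridCube_ne_top k).lt_top).ne

open Matrix in
/-- The preimage of a box under an invertible matrix. -/
theorem volume_preimage_box {n : ℕ} (T : Matrix (Fin n) (Fin n) ℝ) (hT : T.det ≠ 0)
    {p q : Fin n → ℝ} (hpq : p ≤ q) :
    volume.real {u : Fin n → ℝ | T *ᵥ u ∈ Set.Icc p q} = |T.det|⁻¹ * ∏ i, (q i - p i) ∧
      volume {u : Fin n → ℝ | T *ᵥ u ∈ Set.Icc p q} ≠ ∞ := by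
  have h := Measure.addHaar_preimage_linearMap (volume : Measure (Fin n → ℝ))
    (f := Matrix.toLin' T) (by rwa [LinearMap.det_toLin']) (Set.Icc p q)
  have hset : (Matrix.toLin' T) ⁻¹' Set.Icc p q = {u : Fin n → ℝ | T *ᵥ u ∈ Set.Icc p q} := by
    ext u; simp [Matrix.toLin'_apply]
  rw [hset, LinearMap.det_toLin'] at h
  constructor
  · rw [Measure.real, h, ENNReal.toReal_mul, Real.volume_Icc_pi_toReal hpq,
      ENNReal.toReal_ofReal (abs_nonneg _), abs_inv]
  · rw [h, Real.volume_Icc_pi]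
    exact ENNReal.mul_ne_top ENNReal.ofReal_ne_top
      (ENNReal.prod_lt_top fun j _ => ENNReal.ofReal_lt_top).ne

open Matrix in
/-- The preimage of a box under an invertible matrix is bounded. -/
theorem exists_bound_preimage_box {n : ℕ} (T : Matrix (Fin n) (Fin n) ℝ) (hT : T.det ≠ 0)
    (p q : Fin n → ℝ) : ∃ C, ∀ u : Fin n → ℝ, T *ᵥ u ∈ Set.Icc p q → ∀ i, |u i| ≤ C := by
  have hinj : Function.Injective (LinearMap.toContinuousLinearMap (Matrix.toLin' T)) := by
    have := Matrix.mulVec_injective_iff_isUnit.2 ((Matrix.isUnit_iff_isUnit_det T).2 hT.isUnit)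
    exact this
  obtain ⟨K, -, hK⟩ := (LinearMap.injective_iff_antilipschitz (Matrix.toLin' T)).1 hinj
  obtain ⟨C, hC⟩ := (hK.isBounded_preimage (Metric.isBounded_Icc p q)).exists_norm_le
  refine ⟨C, fun u hu i => (norm_le_pi_norm u i).trans (hC u ?_)⟩
  simpa [Matrix.toLin'_apply] using hu

open Matrix in
/-- A parallelepiped is covered by a finite union of grid cubes inside a slightly larger one. -/
theorem exists_gridCube_parallelepiped {n : ℕ} (T : Matrix (Fin n) (Fin n) ℝ) (hT : T.det ≠ 0)
    (p q : Fin n → ℝ) {δ : ℝ} (hδ : 0 < δ) :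
    ∃ m : ℕ, 0 < m ∧ ∃ G : Finset (Fin n → ℤ),
      (∀ u, T *ᵥ u ∈ Set.Icc p q → u ∈ ⋃ k ∈ G, gridCube m k) ∧
      ∀ u ∈ ⋃ k ∈ G, gridCube m k, T *ᵥ u ∈ Set.Icc (fun i => p i - δ) (fun i => q i + δ) := by
  obtain ⟨C, hC⟩ := exists_bound_preimage_box T hT p q
  set S : ℝ := ∑ j, ∑ i, |T j i| with hS
  have hS0 : 0 ≤ S := by positivity
  obtain ⟨m, hm, G, hG, hG'⟩ := exists_gridCube_cover (K := {u | T *ᵥ u ∈ Set.Icc p q})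
    (r := δ / (S + 1)) hC (by positivity)
  refine ⟨m, hm, G, fun u hu => hG hu, fun u hu => ?_⟩
  obtain ⟨w, hw, huw⟩ := hG' u hu
  have key : ∀ j, |(T *ᵥ u) j - (T *ᵥ w) j| ≤ δ := by
    intro j
    rw [← Pi.sub_apply, ← Matrix.mulVec_sub]
    calc |(T *ᵥ (u - w)) j| ≤ ∑ i, |T j i * (u - w) i| := by
          rw [Matrix.mulVec, dotProduct]
          exact Finset.abs_sum_le_sum_abs _ _
      _ ≤ ∑ i, |T j i| * (δ / (S + 1)) := Finset.sum_le_sum fun i _ => by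
          rw [abs_mul]
          exact mul_le_mul_of_nonneg_left (huw i) (abs_nonneg _)
      _ = (∑ i, |T j i|) * (δ / (S + 1)) := by rw [Finset.sum_mul]
      _ ≤ (S + 1) * (δ / (S + 1)) := by
          refine mul_le_mul_of_nonneg_right ?_ (by positivity)
          have : ∑ i, |T j i| ≤ S := Finset.single_le_sum (f := fun j => ∑ i, |T j i|)
            (fun j _ => by positivity) (Finset.mem_univ j)
          linarith
      _ = δ := by field_simp
  refine ⟨fun j => ?_, fun j => ?_⟩
  · linarith [hw.1 j, (abs_le.1 (key j)).1]
  · linarith [hw.2 j, (abs_le.1 (key j)).2]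

/-- The sequence whose first `n` entries are `p` and whose other entries are those of `α`. -/
def glue (n : ℕ) (p : Fin n → ℝ) (α : ℕ → ℝ) (j : ℕ) : ℝ := if h : j < n then p ⟨j, h⟩ else α j

theorem glue_of_lt {n : ℕ} (p : Fin n → ℝ) (α : ℕ → ℝ) {j : ℕ} (h : j < n) :
    glue n p α j = p ⟨j, h⟩ := dif_pos h

theorem glue_of_le {n : ℕ} (p : Fin n → ℝ) (α : ℕ → ℝ) {j : ℕ} (h : n ≤ j) :
    glue n p α j = α j := dif_neg (not_lt.2 h)

theorem glue_add {n : ℕ} (p : Fin n → ℝ) (α : ℕ → ℝ) (k : ℕ) :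
    glue n p α (k + n) = α (k + n) := glue_of_le p α (Nat.le_add_left _ _)

theorem memℓp_glue {n : ℕ} (p : Fin n → ℝ) {α : ℕ → ℝ} {C : ℝ} (hα : ∀ j, n ≤ j → |α j| ≤ C) :
    Memℓp (glue n p α) ∞ := by
  refine memℓp_infty_iff.2 ⟨max C (∑ i, |p i|), ?_⟩
  rintro _ ⟨j, rfl⟩
  rcases lt_or_ge j n with h | h
  · simp only [glue_of_lt p α h, Real.norm_eq_abs]
    exact le_max_of_le_right
      (Finset.single_le_sum (f := fun i => |p i|) (fun i _ => abs_nonneg _) (Finset.mem_univ _))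
  · simp only [glue_of_le p α h, Real.norm_eq_abs]
    exact le_max_of_le_left (hα j h)

theorem summable_log_glue {n : ℕ} (p q : Fin n → ℝ) {α β : ℕ → ℝ}
    (h : Summable fun j => Real.log (β (j + n) - α (j + n))) :
    Summable fun j => Real.log (glue n q β j - glue n p α j) := by
  rw [← summable_nat_add_iff n]
  simpa only [glue_add] using h

theorem edgeProduct_glue {n : ℕ} {p q : Fin n → ℝ} {α β : ℕ → ℝ} (hpq : ∀ i, p i < q i)
    (h : Summable fun j => Real.log (β (j + n) - α (j + n))) :
    edgeProduct (glue n p α) (glue n q β) =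
      (∏ i, (q i - p i)) * Real.exp (∑' j, Real.log (β (j + n) - α (j + n))) := by
  have hs := summable_log_glue p q h
  rw [edgeProduct_eq_exp hs, ← hs.sum_add_tsum_nat_add n, Real.exp_add, Finset.sum_range,
    Real.exp_sum]
  simp only [glue_add]
  congr 1
  refine Finset.prod_congr rfl fun i _ => ?_
  rw [glue_of_lt _ _ i.2, glue_of_lt _ _ i.2, Real.exp_log (sub_pos.2 (hpq _))]

namespace HilbertBasis

variable {H : Type*} [NormedAddCommGroup H] [InnerProductSpace ℝ H]

theorem mem_rectangle_iff (e : HilbertBasis ℕ ℝ H) {a b : ℕ → ℝ} {x : H} :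
    x ∈ e.rectangle a b ↔ ∀ j, inner ℝ (e j) x ∈ Set.Ico (a j) (b j) := Iff.rfl

/-- The set of all `x` whose first `n` coordinates form a point of `U` and whose other coordinates
lie in `[α j, β j)`. -/
def cylinder (e : HilbertBasis ℕ ℝ H) (n : ℕ) (U : Set (Fin n → ℝ)) (α β : ℕ → ℝ) : Set H :=
  {x | (fun i : Fin n => inner ℝ (e i) x) ∈ U ∧
    ∀ j, n ≤ j → inner ℝ (e j) x ∈ Set.Ico (α j) (β j)}

theorem cylinder_pi (e : HilbertBasis ℕ ℝ H) (n : ℕ) (p q : Fin n → ℝ) (α β : ℕ → ℝ) :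
    e.cylinder n (Set.pi Set.univ fun i => Set.Ico (p i) (q i)) α β =
      e.rectangle (glue n p α) (glue n q β) := by
  ext x
  rw [mem_rectangle_iff]
  constructor
  · rintro ⟨h1, h2⟩ j
    rcases lt_or_ge j n with h | h
    · rw [glue_of_lt _ _ h, glue_of_lt _ _ h]
      exact h1 ⟨j, h⟩ trivial
    · rw [glue_of_le _ _ h, glue_of_le _ _ h]
      exact h2 j h
  · intro hx
    refine ⟨fun i _ => ?_, fun j h => ?_⟩
    · have := hx i
      rwa [glue_of_lt _ _ i.2, glue_of_lt _ _ i.2] at this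
    · have := hx j
      rwa [glue_of_le _ _ h, glue_of_le _ _ h] at this

theorem isMeasurableEdges_glue (e : HilbertBasis ℕ ℝ H) {n : ℕ} {p q : Fin n → ℝ} {α β z : ℕ → ℝ}
    {C : ℝ} (hpq : ∀ i, p i < q i) (hα : ∀ j, n ≤ j → |α j| ≤ C) (hβ : ∀ j, n ≤ j → |β j| ≤ C)
    (hz : Summable fun j => z j ^ 2) (hz' : ∀ j, n ≤ j → z j ∈ Set.Ico (α j) (β j))
    (h : Summable fun j => Real.log (β (j + n) - α (j + n))) :
    e.IsMeasurableEdges (glue n p α) (glue n q β) := by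
  refine ⟨memℓp_glue p hα, memℓp_glue q hβ, ?_, ?_⟩
  · have hg : Summable fun j => glue n p z j ^ 2 := by
      rw [← summable_nat_add_iff n] at hz ⊢
      simpa only [glue_add] using hz
    obtain ⟨x, hx⟩ := e.exists_coord_eq hg
    refine ⟨x, fun j => ?_⟩
    rw [hx]
    rcases lt_or_ge j n with h | h
    · simp only [glue_of_lt _ _ h]
      exact ⟨le_rfl, hpq _⟩
    · simp only [glue_of_le _ _ h]
      exact hz' j h
  · exact Summable.of_nonneg_of_le (fun _ => le_max_left _ _)
      (fun j => max_le (abs_nonneg _) (le_abs_self _)) (summable_log_glue p q h).abs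

/-- The volume of a cylinder over a finite union of grid cubes. -/
theorem ringMeasure_cylinder (e : HilbertBasis ℕ ℝ H) {n m : ℕ} (hm : 0 < m)
    (G : Finset (Fin n → ℤ)) {α β z : ℕ → ℝ} {C : ℝ} (hα : ∀ j, n ≤ j → |α j| ≤ C)
    (hβ : ∀ j, n ≤ j → |β j| ≤ C) (hz : Summable fun j => z j ^ 2)
    (hz' : ∀ j, n ≤ j → z j ∈ Set.Ico (α j) (β j))
    (h : Summable fun j => Real.log (β (j + n) - α (j + n))) :
    e.cylinder n (⋃ k ∈ G, gridCube m k) α β ∈ e.rectangleRing ∧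
      e.ringMeasure (e.cylinder n (⋃ k ∈ G, gridCube m k) α β) =
        volume.real (⋃ k ∈ G, gridCube m k) *
          Real.exp (∑' j, Real.log (β (j + n) - α (j + n))) := by
  have hmr : (0 : ℝ) < m := Nat.cast_pos.2 hm
  have hR := e.isSetRing_rectangleRing
  have hlt : ∀ (k : Fin n → ℤ) i, (k i / m : ℝ) < (k i + 1) / m := fun k i =>
    div_lt_div_of_pos_right (by linarith) hmr
  have hedge : ∀ k : Fin n → ℤ, e.IsMeasurableEdges (glue n (fun i => (k i / m : ℝ)) α)
      (glue n (fun i => ((k i : ℝ) + 1) / m) β) := fun k =>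
    e.isMeasurableEdges_glue (hlt k) hα hβ hz hz' h
  have hcube : ∀ k : Fin n → ℤ, e.cylinder n (gridCube m k) α β =
      e.rectangle (glue n (fun i => (k i / m : ℝ)) α) (glue n (fun i => ((k i : ℝ) + 1) / m) β) :=
    fun k => e.cylinder_pi n _ _ α β
  have hmem : ∀ k : Fin n → ℤ, e.cylinder n (gridCube m k) α β ∈ e.rectangleRing := fun k =>
    e.measurableRectangles_subset (Or.inr ⟨_, _, hedge k, hcube k⟩)
  have hunion : e.cylinder n (⋃ k ∈ G, gridCube m k) α β =
      ⋃ k ∈ G, e.cylinder n (gridCube m k) α β := by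
    ext x
    simp only [cylinder, Set.mem_iUnion, exists_prop, Set.mem_ofPred_eq]
    constructor
    · rintro ⟨⟨k, hk, hx⟩, hx'⟩
      exact ⟨k, hk, hx, hx'⟩
    · rintro ⟨k, hk, hx, hx'⟩
      exact ⟨⟨k, hk, hx⟩, hx'⟩
  rw [hunion]
  refine ⟨hR.biUnion_mem G fun k _ => hmem k, ?_⟩
  rw [addContent_biUnion_eq hR (fun k _ => hmem k), volume_biUnion_gridCube hm, Finset.sum_mul]
  · refine Finset.sum_congr rfl fun k _ => ?_
    rw [hcube, e.isRectangleMeasure_ringMeasure.rectangle _ _ (hedge k), edgeProduct_glue (hlt k) h]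
  · intro k _ k' _ hkk
    refine Set.disjoint_left.2 fun x hx hx' => ?_
    exact Set.disjoint_left.1 (pairwise_disjoint_gridCube hm hkk) hx.1 hx'.1

theorem ringMeasure_mono (e : HilbertBasis ℕ ℝ H) {A B : Set H} (hA : A ∈ e.rectangleRing)
    (hB : B ∈ e.rectangleRing) (h : A ⊆ B) :
    0 ≤ e.ringMeasure (B \ A) ∧ e.ringMeasure B = e.ringMeasure (B \ A) + e.ringMeasure A := by
  have hR := e.isSetRing_rectangleRing
  have hBA := hR.sdiff_mem hB hA
  refine ⟨e.isRectangleMeasure_ringMeasure.nonneg _ hBA, ?_⟩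
  have := addContent_union (m := e.ringMeasure) hR hBA hA Set.disjoint_sdiff_left
  rwa [Set.sdiff_union_of_subset h] at this

/-- Inner and outer approximation determines the measure. -/
theorem mem_measurableRing_of_approx (e : HilbertBasis ℕ ℝ H) {Q : Set H} {V : ℝ}
    (h : ∀ ε : ℝ, 0 < ε → ∃ A₁ ∈ e.rectangleRing, ∃ A₂ ∈ e.rectangleRing, A₁ ⊆ Q ∧ Q ⊆ A₂ ∧
      V - ε ≤ e.ringMeasure A₁ ∧ e.ringMeasure A₂ ≤ V + ε) :
    Q ∈ e.measurableRing ∧ e.measure Q = V := by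
  constructor
  · intro ε hε
    obtain ⟨A₁, h1, A₂, h2, h3, h4, h5, h6⟩ := h (ε / 3) (by positivity)
    refine ⟨A₁, h1, A₂, h2, h3, h4, ?_⟩
    have := (e.ringMeasure_mono h1 h2 (h3.trans h4)).2
    linarith
  · have hlow : ∀ r ∈ {r | ∃ B ∈ e.rectangleRing, Q ⊆ B ∧ r = e.ringMeasure B}, V ≤ r := by
      rintro _ ⟨B, hB, hQB, rfl⟩
      refine le_of_forall_pos_le_add fun ε hε => ?_
      obtain ⟨A₁, h1, A₂, h2, h3, h4, h5, h6⟩ := h ε hε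
      have := e.ringMeasure_mono h1 hB (h3.trans hQB)
      linarith [this.1, this.2]
    refine le_antisymm (le_of_forall_pos_le_add fun ε hε => ?_) ?_
    · obtain ⟨A₁, h1, A₂, h2, h3, h4, h5, h6⟩ := h ε hε
      exact (csInf_le ⟨V, hlow⟩ ⟨A₂, h2, h4, rfl⟩).trans h6
    · obtain ⟨A₁, h1, A₂, h2, h3, h4, h5, h6⟩ := h 1 one_pos
      exact le_csInf ⟨_, A₂, h2, h4, rfl⟩ hlow

end HilbertBasis

namespace HilbertBasis

variable {H : Type*} [NormedAddCommGroup H] [InnerProductSpace ℝ H]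

/-- The absolute value of an entry of the transition matrix minus the identity. -/
def defect (e f : HilbertBasis ℕ ℝ H) (i j : ℕ) : ℝ :=
  |inner ℝ (e i) (f j) - if i = j then 1 else 0|

/-- The transition matrix differs from the identity by a matrix with absolutely summable
entries. -/
def IsClose (e f : HilbertBasis ℕ ℝ H) : Prop :=
  Summable fun p : ℕ × ℕ => e.defect f p.1 p.2

theorem defect_nonneg (e f : HilbertBasis ℕ ℝ H) (i j : ℕ) : 0 ≤ e.defect f i j := abs_nonneg _

theorem defect_swap (e f : HilbertBasis ℕ ℝ H) (i j : ℕ) : f.defect e j i = e.defect f i j := by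
  simp only [defect, real_inner_comm, eq_comm]

theorem abs_inner_eq_defect (e f : HilbertBasis ℕ ℝ H) {i j : ℕ} (h : i ≠ j) :
    |inner ℝ (e i) (f j)| = e.defect f i j := by
  simp [defect, h]

theorem IsClose.symm {e f : HilbertBasis ℕ ℝ H} (h : e.IsClose f) : f.IsClose e := by
  refine (h.comp_injective (Equiv.prodComm ℕ ℕ).injective).congr fun p => ?_
  simp [defect_swap]

theorem IsClose.summable_column {e f : HilbertBasis ℕ ℝ H} (h : e.IsClose f) (j : ℕ) :
    Summable fun i => e.defect f i j :=
  (h.comp_injective (Prod.mk_left_injective j)).congr fun _ => rfl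

theorem IsClose.summable_row {e f : HilbertBasis ℕ ℝ H} (h : e.IsClose f) (i : ℕ) :
    Summable fun j => e.defect f i j :=
  h.prod_factor i

/-- A positive sequence dominating the row and column sums of the defect. -/
def width (e f : HilbertBasis ℕ ℝ H) (j : ℕ) : ℝ :=
  ∑' i, e.defect f i j + ∑' i, e.defect f j i + (1 / 2) ^ j

theorem width_swap (e f : HilbertBasis ℕ ℝ H) (j : ℕ) : f.width e j = e.width f j := by
  simp only [width, defect_swap e f]
  ring

theorem column_lt_width (e f : HilbertBasis ℕ ℝ H) (j : ℕ) :
    ∑' i, e.defect f i j < e.width f j := by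
  have h1 : 0 ≤ ∑' i, e.defect f j i := tsum_nonneg fun i => e.defect_nonneg f j i
  have h2 : (0 : ℝ) < (1 / 2) ^ j := by positivity
  rw [width]
  linarith

theorem row_lt_width (e f : HilbertBasis ℕ ℝ H) (j : ℕ) :
    ∑' i, e.defect f j i < e.width f j := by
  rw [← width_swap]
  simpa only [defect_swap] using f.column_lt_width e j

theorem width_pos (e f : HilbertBasis ℕ ℝ H) (j : ℕ) : 0 < e.width f j :=
  (tsum_nonneg fun i => e.defect_nonneg f i j).trans_lt (e.column_lt_width f j)

theorem IsClose.summable_width {e f : HilbertBasis ℕ ℝ H} (h : e.IsClose f) :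
    Summable (e.width f) := by
  have h1 : Summable fun i => ∑' j, e.defect f i j :=
    Summable.prod (f := fun p : ℕ × ℕ => e.defect f p.1 p.2) h
  have h2 : Summable fun j => ∑' i, f.defect e j i :=
    Summable.prod (f := fun p : ℕ × ℕ => f.defect e p.1 p.2) h.symm
  simp only [defect_swap e f] at h2
  have h3 : Summable fun j : ℕ => (1 / 2 : ℝ) ^ j :=
    summable_geometric_of_lt_one (by norm_num) (by norm_num)
  exact ((h2.add h1).add h3).congr fun j => rfl

/-- The tail of the series of the widths. -/
def tailWidth (e f : HilbertBasis ℕ ℝ H) (n : ℕ) : ℝ := ∑' k, e.width f (k + n)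

theorem tendsto_tailWidth (e f : HilbertBasis ℕ ℝ H) :
    Tendsto (e.tailWidth f) atTop (𝓝 0) :=
  tendsto_sum_nat_add (e.width f)

theorem tailWidth_swap (e f : HilbertBasis ℕ ℝ H) (n : ℕ) :
    f.tailWidth e n = e.tailWidth f n := by
  simp only [tailWidth, width_swap e f]

theorem IsClose.tailWidth_pos {e f : HilbertBasis ℕ ℝ H} (h : e.IsClose f) (n : ℕ) :
    0 < e.tailWidth f n :=
  ((summable_nat_add_iff n).2 h.summable_width).tsum_pos (fun _ => (e.width_pos f _).le) 0
    (e.width_pos f _)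

theorem IsClose.width_le_tailWidth {e f : HilbertBasis ℕ ℝ H} (h : e.IsClose f) {n j : ℕ}
    (hj : n ≤ j) : e.width f j ≤ e.tailWidth f n := by
  have := ((summable_nat_add_iff n).2 h.summable_width).le_tsum (j - n)
    fun _ _ => (e.width_pos f _).le
  simpa only [tailWidth, Nat.sub_add_cancel hj] using this

theorem abs_coord_sub_le {e f : HilbertBasis ℕ ℝ H} (h : e.IsClose f) {x : H} {B : ℝ}
    (hx : ∀ i, |inner ℝ (e i) x| ≤ B) (j : ℕ) :
    |inner ℝ (f j) x - inner ℝ (e j) x| ≤ B * ∑' i, e.defect f i j := by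
  have h1 := (e.hasSum_inner_mul_inner (f j) x).sub (hasSum_ite_eq j (inner ℝ (e j) x))
  have h2 : HasSum (fun i => B * e.defect f i j) (B * ∑' i, e.defect f i j) :=
    (h.summable_column j).hasSum.mul_left B
  rw [← h1.tsum_eq, ← Real.norm_eq_abs]
  refine tsum_of_norm_bounded h2 fun i => ?_
  have : inner ℝ (f j) (e i) * inner ℝ (e i) x - (if i = j then inner ℝ (e j) x else 0) =
      inner ℝ (e i) x * (inner ℝ (e i) (f j) - if i = j then 1 else 0) := by
    rw [real_inner_comm]
    split_ifs with hij
    · rw [hij]; ring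
    · ring
  rw [this, Real.norm_eq_abs, abs_mul]
  exact mul_le_mul_of_nonneg_right (hx i) (abs_nonneg _)

theorem abs_coord_sub_lt {e f : HilbertBasis ℕ ℝ H} (h : e.IsClose f) {x : H} {B : ℝ}
    (hB : 0 < B) (hx : ∀ i, |inner ℝ (e i) x| ≤ B) (j : ℕ) :
    |inner ℝ (f j) x - inner ℝ (e j) x| < B * e.width f j :=
  (abs_coord_sub_le h hx j).trans_lt (mul_lt_mul_of_pos_left (e.column_lt_width f j) hB)

/-- The mass of the `j`-th column of the defect below row `n`. -/
def prefixError (e f : HilbertBasis ℕ ℝ H) (n j : ℕ) : ℝ := ∑' k, e.defect f (k + n) j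

theorem prefixError_nonneg (e f : HilbertBasis ℕ ℝ H) (n j : ℕ) : 0 ≤ e.prefixError f n j :=
  tsum_nonneg fun _ => e.defect_nonneg f _ _

theorem sum_prefixError_le {e f : HilbertBasis ℕ ℝ H} (h : e.IsClose f) (n : ℕ) (s : Finset ℕ) :
    ∑ j ∈ s, e.prefixError f n j ≤ e.tailWidth f n := by
  have hc : ∀ j, Summable fun k => e.defect f (k + n) j := fun j =>
    (summable_nat_add_iff n).2 (h.summable_column j)
  simp only [prefixError, tailWidth]
  rw [← Summable.tsum_finsetSum fun j _ => hc j]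
  refine Summable.tsum_le_tsum (fun k => ?_) (summable_sum fun j _ => hc j)
    ((summable_nat_add_iff n).2 h.summable_width)
  exact ((h.summable_row (k + n)).sum_le_tsum s fun j _ => e.defect_nonneg f _ _).trans
    (e.row_lt_width f _).le

theorem prefixError_le {e f : HilbertBasis ℕ ℝ H} (h : e.IsClose f) (n j : ℕ) :
    e.prefixError f n j ≤ e.tailWidth f n := by
  simpa using sum_prefixError_le h n {j}

open Matrix in
/-- The corner of size `n` of the matrix expressing the coordinates with respect to `f` by those
with respect to `e`. -/
def corner (e f : HilbertBasis ℕ ℝ H) (n : ℕ) : Matrix (Fin n) (Fin n) ℝ :=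
  Matrix.of fun j i => inner ℝ (f j) (e i)

open Matrix in
theorem corner_mulVec (e f : HilbertBasis ℕ ℝ H) (n : ℕ) (u : Fin n → ℝ) (j : Fin n) :
    (e.corner f n *ᵥ u) j = ∑ i : Fin n, inner ℝ (f j) (e i) * u i := rfl

open Matrix in
theorem abs_coord_sub_corner_le {e f : HilbertBasis ℕ ℝ H} (h : e.IsClose f) {x : H} {B : ℝ}
    (hx : ∀ i, |inner ℝ (e i) x| ≤ B) {n : ℕ} (j : Fin n) :
    |inner ℝ (f j) x - (e.corner f n *ᵥ fun i : Fin n => inner ℝ (e i) x) j| ≤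
      B * e.prefixError f n j := by
  have h1 := e.hasSum_inner_mul_inner (f j) x
  have h2 := h1.summable.sum_add_tsum_nat_add n
  rw [h1.tsum_eq, Finset.sum_range] at h2
  rw [corner_mulVec, ← h2, add_sub_cancel_left, ← Real.norm_eq_abs]
  have h3 : HasSum (fun k => B * e.defect f (k + n) j) (B * e.prefixError f n j) :=
    ((summable_nat_add_iff n).2 (h.summable_column j)).hasSum.mul_left B
  refine tsum_of_norm_bounded h3 fun k => ?_
  rw [Real.norm_eq_abs, abs_mul, real_inner_comm, abs_inner_eq_defect e f (by omega), mul_comm]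
  exact mul_le_mul_of_nonneg_right (hx _) (e.defect_nonneg f _ _)

open Matrix in
theorem det_corner_bounds {e f : HilbertBasis ℕ ℝ H} (h : e.IsClose f) (n : ℕ) :
    1 - e.tailWidth f n ≤ |(e.corner f n).det| ∧ |(e.corner f n).det| ≤ 1 := by
  have hcon : ∀ v : Fin n → ℝ, ∑ j, (e.corner f n *ᵥ v) j ^ 2 ≤ ∑ i, v i ^ 2 := by
    intro v
    set x : H := ∑ i : Fin n, v i • e i with hx
    have h1 : ∀ j : Fin n, (e.corner f n *ᵥ v) j = inner ℝ (f j) x := by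
      intro j
      rw [corner_mulVec, hx, inner_sum]
      exact Finset.sum_congr rfl fun i _ => by rw [real_inner_smul_right, mul_comm]
    have h2 : ‖x‖ ^ 2 = ∑ i, v i ^ 2 := by
      have := (e.orthonormal.comp (fun i : Fin n => (i : ℕ)) Fin.val_injective).inner_sum v v
        Finset.univ
      simp only [Function.comp_apply, ← hx] at this
      rw [← real_inner_self_eq_norm_sq, this]
      simp [sq]
    rw [← h2]
    simp only [h1]
    rw [← Finset.sum_range fun j => inner ℝ (f j) x ^ 2]
    exact sum_le_hasSum _ (fun _ _ => sq_nonneg _) (f.hasSum_inner_sq x)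
  obtain ⟨h1, h2⟩ := det_sq_bounds _ hcon
  have hdet := (sq_le_one_iff_abs_le_one _).1 h2
  refine ⟨?_, hdet⟩
  have h3 : ∑ i : Fin n, (1 - ∑ j : Fin n, e.corner f n j i ^ 2) ≤ e.tailWidth f n := by
    rw [← tailWidth_swap]
    refine le_trans ?_ (sum_prefixError_le h.symm n (Finset.range n))
    rw [Finset.sum_range]
    refine Finset.sum_le_sum fun i _ => ?_
    have h4 := f.hasSum_inner_basis_sq e i
    have h5 := h4.summable.sum_add_tsum_nat_add n
    rw [h4.tsum_eq, Finset.sum_range] at h5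
    have h6 : ∑' k, inner ℝ (f (k + n)) (e i) ^ 2 ≤ f.prefixError e n i := by
      refine Summable.tsum_le_tsum (fun k => ?_) ((summable_nat_add_iff n).2 h4.summable)
        ((summable_nat_add_iff n).2 (h.symm.summable_column i))
      rw [← abs_inner_eq_defect f e (by omega), ← sq_abs]
      have h7 : inner ℝ (f (k + n)) (e i) ^ 2 ≤ 1 := le_hasSum h4 _ fun _ _ => sq_nonneg _
      have h8 := (sq_le_one_iff_abs_le_one _).1 h7
      nlinarith [abs_nonneg (inner ℝ (f (k + n)) (e i))]
    have h9 : ∑ j : Fin n, e.corner f n j i ^ 2 = ∑ j : Fin n, inner ℝ (f j) (e i) ^ 2 := rfl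
    rw [h9]
    linarith
  have h10 : (e.corner f n).det ^ 2 ≤ |(e.corner f n).det| := by
    rw [← sq_abs]
    nlinarith [abs_nonneg (e.corner f n).det]
  linarith

open Matrix in
/-- A vector whose first `n` coordinates are mapped into a cube by the corner and whose other
coordinates are bounded has bounded coordinates, uniformly in `n`. -/
theorem abs_coord_le_of_corner {e f : HilbertBasis ℕ ℝ H} (h : e.IsClose f) {x : H} {M : ℝ}
    {n : ℕ} (hn : 2 * (1 + ∑' j, e.width f j) * e.tailWidth f n ≤ 1)
    (h1 : ∀ j : Fin n, |(e.corner f n *ᵥ fun i : Fin n => inner ℝ (e i) x) j| ≤ M)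
    (h2 : ∀ j, n ≤ j → |inner ℝ (e j) x| ≤ M) (i : ℕ) :
    |inner ℝ (e i) x| ≤ 2 * (1 + ∑' j, e.width f j) * M := by
  set Θ := ∑' j, e.width f j with hΘ
  have hbdd : BddAbove (Set.range fun i => |inner ℝ (e i) x|) := by
    refine ⟨‖x‖, ?_⟩
    rintro _ ⟨i, rfl⟩
    have := abs_real_inner_le_norm (e i) x
    rwa [e.orthonormal.1 i, one_mul] at this
  set X := ⨆ i, |inner ℝ (e i) x| with hX
  have hiX : ∀ i, |inner ℝ (e i) x| ≤ X := fun i => le_ciSup hbdd i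
  have hX0 : 0 ≤ X := (abs_nonneg _).trans (hiX 0)
  have hK0 := (h.tailWidth_pos n).le
  have hy : ∀ j, |inner ℝ (f j) x| ≤ M + X * e.tailWidth f n := by
    intro j
    rcases lt_or_ge j n with hj | hj
    · have h3 := abs_coord_sub_corner_le h hiX ⟨j, hj⟩
      have h4 := mul_le_mul_of_nonneg_left (prefixError_le h n j) hX0
      have h5 := h1 ⟨j, hj⟩
      rw [abs_le] at h3 h5 ⊢
      constructor <;> linarith [h3.1, h3.2, h5.1, h5.2]
    · have h3 := abs_coord_sub_le h hiX j
      have h4 := mul_le_mul_of_nonneg_left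
        ((e.column_lt_width f j).le.trans (h.width_le_tailWidth hj)) hX0
      have h5 := h2 j hj
      rw [abs_le] at h3 h5 ⊢
      constructor <;> linarith [h3.1, h3.2, h5.1, h5.2]
  have hY0 : 0 ≤ M + X * e.tailWidth f n := (abs_nonneg _).trans (hy 0)
  have hx : ∀ i, |inner ℝ (e i) x| ≤ (1 + Θ) * (M + X * e.tailWidth f n) := by
    intro i
    have h3 := abs_coord_sub_le h.symm hy i
    have h4 : ∑' k, f.defect e k i ≤ Θ := by
      refine (f.column_lt_width e i).le.trans ?_
      rw [width_swap]
      exact h.summable_width.le_tsum i fun _ _ => (e.width_pos f _).le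
    have h5 := mul_le_mul_of_nonneg_left h4 hY0
    have h6 := hy i
    rw [abs_le] at h3 h6 ⊢
    constructor <;> linarith [h3.1, h3.2, h6.1, h6.2]
  have h7 : X ≤ (1 + Θ) * (M + X * e.tailWidth f n) := ciSup_le hx
  have h8 := mul_le_mul_of_nonneg_left hn hX0
  exact (hiX i).trans (by nlinarith)

end HilbertBasis

theorem exp_tsum_log_eq_prod_mul {l : ℕ → ℝ} (hl : ∀ j, 0 < l j)
    (h : Summable fun j => Real.log (l j)) (n : ℕ) :
    Real.exp (∑' j, Real.log (l j)) =
      (∏ i : Fin n, l i) * Real.exp (∑' j, Real.log (l (j + n))) := by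
  rw [← h.sum_add_tsum_nat_add n, Real.exp_add, Finset.sum_range, Real.exp_sum]
  congr 1
  exact Finset.prod_congr rfl fun i _ => Real.exp_log (hl _)

namespace HilbertBasis

variable {H : Type*} [NormedAddCommGroup H] [InnerProductSpace ℝ H]

/-- The extra room given to the first `n` coordinates of an approximating cylinder beyond the
error made by truncation. -/
def slack (e f : HilbertBasis ℕ ℝ H) (n : ℕ) : ℝ := e.tailWidth f n / (n + 1)

/-- The amount by which the edges of a rectangle are moved to obtain an approximating cylinder. -/
def margin (e f : HilbertBasis ℕ ℝ H) (B : ℝ) (n : ℕ) : ℕ → ℝ :=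
  glue n (fun j => B * e.prefixError f n j + e.slack f n) fun j => B * e.width f j

theorem IsClose.slack_pos {e f : HilbertBasis ℕ ℝ H} (h : e.IsClose f) (n : ℕ) :
    0 < e.slack f n :=
  div_pos (h.tailWidth_pos n) (by positivity)

theorem margin_of_fin (e f : HilbertBasis ℕ ℝ H) (B : ℝ) {n : ℕ} (i : Fin n) :
    e.margin f B n i = B * e.prefixError f n i + e.slack f n :=
  glue_of_lt _ _ i.2

theorem margin_of_le (e f : HilbertBasis ℕ ℝ H) (B : ℝ) {n j : ℕ} (h : n ≤ j) :
    e.margin f B n j = B * e.width f j :=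
  glue_of_le _ _ h

theorem IsClose.margin_nonneg {e f : HilbertBasis ℕ ℝ H} (h : e.IsClose f) {B : ℝ} (hB : 0 ≤ B)
    (n j : ℕ) : 0 ≤ e.margin f B n j := by
  rcases lt_or_ge j n with hj | hj
  · rw [e.margin_of_fin f B ⟨j, hj⟩]
    exact add_nonneg (mul_nonneg hB (e.prefixError_nonneg f n j)) (h.slack_pos n).le
  · rw [e.margin_of_le f B hj]
    exact mul_nonneg hB (e.width_pos f j).le

theorem IsClose.summable_margin {e f : HilbertBasis ℕ ℝ H} (h : e.IsClose f) (B : ℝ) (n : ℕ) :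
    Summable (e.margin f B n) := by
  rw [← summable_nat_add_iff n]
  refine (((summable_nat_add_iff n).2 h.summable_width).mul_left B).congr fun k => ?_
  rw [e.margin_of_le f B (Nat.le_add_left _ _)]

theorem IsClose.tsum_margin_le {e f : HilbertBasis ℕ ℝ H} (h : e.IsClose f) {B : ℝ} (hB : 0 ≤ B)
    (n : ℕ) : ∑' j, e.margin f B n j ≤ (2 * B + 1) * e.tailWidth f n := by
  rw [← (h.summable_margin B n).sum_add_tsum_nat_add n, Finset.sum_range]
  have h1 : ∑' k, e.margin f B n (k + n) = B * e.tailWidth f n := by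
    rw [tailWidth, ← tsum_mul_left]
    exact tsum_congr fun k => e.margin_of_le f B (Nat.le_add_left _ _)
  have h2 : ∑ i : Fin n, e.margin f B n i =
      B * ∑ j ∈ Finset.range n, e.prefixError f n j + n * e.slack f n := by
    simp only [margin_of_fin]
    rw [Finset.sum_add_distrib, ← Finset.mul_sum, Finset.sum_range]
    simp
  have h3 := mul_le_mul_of_nonneg_left (sum_prefixError_le h n (Finset.range n)) hB
  have h4 : n * e.slack f n ≤ e.tailWidth f n := by
    rw [slack, mul_div_assoc', div_le_iff₀ (by positivity)]
    nlinarith [h.tailWidth_pos n]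
  rw [h1, h2]
  linarith

/-- The bound for the coordinates of the points of all approximating cylinders. -/
def coordBound (e f : HilbertBasis ℕ ℝ H) (M : ℝ) : ℝ := 2 * (1 + ∑' j, e.width f j) * M

theorem le_coordBound (e f : HilbertBasis ℕ ℝ H) {M : ℝ} (hM : 0 ≤ M) :
    M * (1 + ∑' j, e.width f j) ≤ e.coordBound f M ∧ M ≤ e.coordBound f M := by
  have h0 : 0 ≤ ∑' j, e.width f j := tsum_nonneg fun j => (e.width_pos f j).le
  rw [coordBound]
  constructor <;> nlinarith [mul_nonneg hM h0]

theorem IsClose.abs_coord_le {e f : HilbertBasis ℕ ℝ H} (h : e.IsClose f) {M : ℝ} (hM : 0 ≤ M)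
    {x : H} (hx : ∀ j, |inner ℝ (f j) x| ≤ M) (i : ℕ) :
    |inner ℝ (e i) x| ≤ e.coordBound f M := by
  refine le_trans ?_ (e.le_coordBound f hM).1
  have h1 := abs_coord_sub_le h.symm hx i
  have h2 : ∑' k, f.defect e k i ≤ ∑' j, e.width f j := by
    refine (f.column_lt_width e i).le.trans ?_
    rw [width_swap]
    exact h.summable_width.le_tsum i fun _ _ => (e.width_pos f _).le
  have h3 := mul_le_mul_of_nonneg_left h2 hM
  have h4 := hx i
  rw [abs_le] at h1 h4 ⊢
  constructor <;> linarith [h1.1, h1.2, h4.1, h4.2]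

/-- Lengthening or shortening the edges by twice the margin hardly changes the infinite product. -/
theorem IsClose.margin_perturb {e f : HilbertBasis ℕ ℝ H} (h : e.IsClose f) {a b : ℕ → ℝ}
    {B m : ℝ} (hB : 0 ≤ B) (hm : 0 < m) (hml : ∀ j, m ≤ b j - a j)
    (hl : Summable fun j => Real.log (b j - a j)) {n : ℕ}
    (hn : 4 * ((2 * B + 1) * e.tailWidth f n) ≤ m) {s : ℝ} (hs : |s| = 2) :
    (∀ j, 0 < b j - a j + s * e.margin f B n j) ∧
      (Summable fun j => Real.log (b j - a j + s * e.margin f B n j)) ∧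
      Real.exp (∑' j, Real.log (b j - a j + s * e.margin f B n j)) ≤
        edgeProduct a b * Real.exp (4 * ((2 * B + 1) * e.tailWidth f n) / m) ∧
      edgeProduct a b * Real.exp (-(4 * ((2 * B + 1) * e.tailWidth f n) / m)) ≤
        Real.exp (∑' j, Real.log (b j - a j + s * e.margin f B n j)) := by
  have habs : ∀ j, |s * e.margin f B n j| = 2 * e.margin f B n j := fun j => by
    rw [abs_mul, hs, abs_of_nonneg (h.margin_nonneg hB n j)]
  have hsum : Summable fun j => |s * e.margin f B n j| := by
    simp only [habs]
    exact (h.summable_margin B n).mul_left 2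
  have hle : 2 * ∑' j, |s * e.margin f B n j| ≤ 4 * ((2 * B + 1) * e.tailWidth f n) := by
    simp only [habs]
    rw [tsum_mul_left]
    linarith [h.tsum_margin_le hB n]
  obtain ⟨h1, h2, h3, h4⟩ := exp_tsum_log_perturb hm hml hl hsum (hle.trans hn)
  have hV : 0 ≤ edgeProduct a b := by
    rw [edgeProduct_eq_exp hl]
    exact (Real.exp_pos _).le
  rw [← edgeProduct_eq_exp hl] at h3 h4
  refine ⟨h1, h2, h3.trans ?_, le_trans ?_ h4⟩
  · refine mul_le_mul_of_nonneg_left (Real.exp_le_exp.2 ?_) hV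
    exact div_le_div_of_nonneg_right hle hm.le
  · refine mul_le_mul_of_nonneg_left (Real.exp_le_exp.2 (neg_le_neg ?_)) hV
    exact div_le_div_of_nonneg_right hle hm.le

theorem IsClose.abs_margin_le {e f : HilbertBasis ℕ ℝ H} (h : e.IsClose f) {B : ℝ} (hB : 0 ≤ B)
    (j : ℕ) : |B * e.width f j| ≤ B * ∑' j, e.width f j := by
  rw [abs_of_nonneg (mul_nonneg hB (e.width_pos f j).le)]
  exact mul_le_mul_of_nonneg_left
    (h.summable_width.le_tsum j fun _ _ => (e.width_pos f _).le) hB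

open Matrix in
theorem IsClose.exists_outer {e f : HilbertBasis ℕ ℝ H} (h : e.IsClose f) {a b : ℕ → ℝ} {M m : ℝ}
    (hM : 0 < M) (ha : ∀ j, |a j| ≤ M) (hb : ∀ j, |b j| ≤ M) (hm : 0 < m)
    (hml : ∀ j, m ≤ b j - a j) (hl : Summable fun j => Real.log (b j - a j)) {Q : Set H}
    (hQ : ∀ x ∈ Q, ∀ j, inner ℝ (f j) x ∈ Set.Icc (a j) (b j)) (hne : Q.Nonempty) {n : ℕ}
    (hn1 : e.tailWidth f n < 1)
    (hn : 4 * ((2 * e.coordBound f M + 1) * e.tailWidth f n) ≤ m) :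
    ∃ A ∈ e.rectangleRing, Q ⊆ A ∧ e.ringMeasure A ≤ (1 - e.tailWidth f n)⁻¹ *
      (edgeProduct a b *
        Real.exp (4 * ((2 * e.coordBound f M + 1) * e.tailWidth f n) / m)) := by
  set B := e.coordBound f M with hBdef
  have hMB : M ≤ B := (e.le_coordBound f hM.le).2
  have hB : 0 < B := hM.trans_le hMB
  obtain ⟨hd1, -⟩ := det_corner_bounds h n
  have hdet0 : 0 < |(e.corner f n).det| := by linarith
  have hδ := h.slack_pos n
  obtain ⟨k, hk, G, hG, hG'⟩ := exists_gridCube_parallelepiped (e.corner f n) (abs_pos.1 hdet0)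
    (fun i => a i - B * e.prefixError f n i) (fun i => b i + B * e.prefixError f n i) hδ
  obtain ⟨hp1, hp2, hp3, -⟩ := h.margin_perturb hB.le hm hml hl hn (s := 2) (by norm_num)
  set c := e.margin f B n with hc
  have hyM : ∀ x ∈ Q, ∀ j, |inner ℝ (f j) x| ≤ M := fun x hx j => by
    have h1 := hQ x hx j
    have h2 := abs_le.1 (ha j)
    have h3 := abs_le.1 (hb j)
    exact abs_le.2 ⟨h2.1.trans h1.1, h1.2.trans h3.2⟩
  obtain ⟨x₀, hx₀⟩ := hne
  have htail : ∀ j, b (j + n) + B * e.width f (j + n) - (a (j + n) - B * e.width f (j + n)) =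
      b (j + n) - a (j + n) + 2 * c (j + n) := fun j => by
    rw [hc, e.margin_of_le f B (Nat.le_add_left n j)]
    ring
  have hbnd : ∀ j, |B * e.width f j| ≤ B * ∑' j, e.width f j := h.abs_margin_le hB.le
  obtain ⟨hmem, hmeas⟩ := e.ringMeasure_cylinder hk G (α := fun j => a j - B * e.width f j)
    (β := fun j => b j + B * e.width f j) (z := fun j => inner ℝ (f j) x₀)
    (C := M + B * ∑' j, e.width f j)
    (fun j _ => (abs_sub _ _).trans (add_le_add (ha j) (hbnd j)))
    (fun j _ => (abs_add_le _ _).trans (add_le_add (hb j) (hbnd j)))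
    (f.summable_sq_coord x₀)
    (fun j _ => by
      have h1 := hQ x₀ hx₀ j
      have h2 := mul_pos hB (e.width_pos f j)
      exact ⟨by linarith [h1.1], by linarith [h1.2]⟩)
    (by
      simp only [htail]
      exact (summable_nat_add_iff n).2 hp2)
  refine ⟨_, hmem, ?_, ?_⟩
  · intro x hx
    have hxB := h.abs_coord_le hM.le (hyM x hx)
    refine ⟨hG _ ?_, fun j _ => ?_⟩
    · have h1 : ∀ i : Fin n, _ := fun i => abs_le.1 (abs_coord_sub_corner_le h hxB i)
      have h2 : ∀ i : Fin n, _ := fun i => hQ x hx i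
      exact ⟨fun i => by linarith [(h1 i).2, (h2 i).1], fun i => by linarith [(h1 i).1, (h2 i).2]⟩
    · have h1 := abs_lt.1 (abs_coord_sub_lt h.symm hB (fun i => (hyM x hx i).trans hMB) j)
      rw [width_swap] at h1
      have h2 := hQ x hx j
      exact ⟨by linarith [h1.1, h2.1], by linarith [h1.2, h2.2]⟩
  · rw [hmeas]
    simp only [htail]
    have hbox : ∀ i : Fin n, b i + B * e.prefixError f n i + e.slack f n -
        (a i - B * e.prefixError f n i - e.slack f n) = b i - a i + 2 * c i := fun i => by
      rw [hc, e.margin_of_fin f B i]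
      ring
    obtain ⟨hv1, hv2⟩ := volume_preimage_box (e.corner f n) (abs_pos.1 hdet0)
      (p := fun i => a i - B * e.prefixError f n i - e.slack f n)
      (q := fun i => b i + B * e.prefixError f n i + e.slack f n)
      (fun i => by
        rw [← sub_nonneg, hbox]
        exact (hp1 i).le)
    simp only [hbox] at hv1
    have hvol : volume.real (⋃ k' ∈ G, gridCube k k') ≤
        |(e.corner f n).det|⁻¹ * ∏ i : Fin n, (b i - a i + 2 * c i) := by
      rw [← hv1]
      exact measureReal_mono hG' hv2
    have hinv : |(e.corner f n).det|⁻¹ ≤ (1 - e.tailWidth f n)⁻¹ :=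
      inv_anti₀ (by linarith) hd1
    calc _ ≤ |(e.corner f n).det|⁻¹ * (∏ i : Fin n, (b i - a i + 2 * c i)) *
          Real.exp (∑' j, Real.log (b (j + n) - a (j + n) + 2 * c (j + n))) :=
          mul_le_mul_of_nonneg_right hvol (Real.exp_pos _).le
      _ = |(e.corner f n).det|⁻¹ * Real.exp (∑' j, Real.log (b j - a j + 2 * c j)) := by
          rw [exp_tsum_log_eq_prod_mul hp1 hp2 n, mul_assoc]
      _ ≤ _ := mul_le_mul hinv hp3 (Real.exp_pos _).le (inv_nonneg.2 (by linarith))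

open Matrix in
theorem IsClose.exists_inner {e f : HilbertBasis ℕ ℝ H} (h : e.IsClose f) {a b : ℕ → ℝ} {M m : ℝ}
    (hM : 0 < M) (ha : ∀ j, |a j| ≤ M) (hb : ∀ j, |b j| ≤ M) (hm : 0 < m)
    (hml : ∀ j, m ≤ b j - a j) (hl : Summable fun j => Real.log (b j - a j)) {Q : Set H}
    (hQ : ∀ x ∈ Q, ∀ j, inner ℝ (f j) x ∈ Set.Icc (a j) (b j)) (hne : Q.Nonempty)
    (hQ' : ∀ x, (∀ j, inner ℝ (f j) x ∈ Set.Ioo (a j) (b j)) → x ∈ Q) {n : ℕ}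
    (hn1 : e.tailWidth f n < 1) (hn2 : 2 * (1 + ∑' j, e.width f j) * e.tailWidth f n ≤ 1)
    (hn : 4 * ((2 * e.coordBound f M + 1) * e.tailWidth f n) ≤ m) :
    ∃ A ∈ e.rectangleRing, A ⊆ Q ∧ edgeProduct a b *
        Real.exp (-(4 * ((2 * e.coordBound f M + 1) * e.tailWidth f n) / m)) ≤
      e.ringMeasure A := by
  set B := e.coordBound f M with hBdef
  have hMB : M ≤ B := (e.le_coordBound f hM.le).2
  have hB : 0 < B := hM.trans_le hMB
  obtain ⟨hd1, hd2⟩ := det_corner_bounds h n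
  have hdet0 : 0 < |(e.corner f n).det| := by linarith
  have hδ := h.slack_pos n
  obtain ⟨hp1, hp2, -, hp3⟩ := h.margin_perturb hB.le hm hml hl hn (s := -2) (by norm_num)
  set c := e.margin f B n with hc
  obtain ⟨k, hk, G, hG, hG'⟩ := exists_gridCube_parallelepiped (e.corner f n) (abs_pos.1 hdet0)
    (fun i => a i + c i) (fun i => b i - c i) (half_pos hδ)
  obtain ⟨x₀, hx₀⟩ := hne
  have htail : ∀ j, b (j + n) - B * e.width f (j + n) - (a (j + n) + B * e.width f (j + n)) =
      b (j + n) - a (j + n) + -2 * c (j + n) := fun j => by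
    rw [hc, e.margin_of_le f B (Nat.le_add_left n j)]
    ring
  have hbnd : ∀ j, |B * e.width f j| ≤ B * ∑' j, e.width f j := h.abs_margin_le hB.le
  have hBw : ∀ j, 0 < B * e.width f j := fun j => mul_pos hB (e.width_pos f j)
  obtain ⟨hmem, hmeas⟩ := e.ringMeasure_cylinder hk G (α := fun j => a j + B * e.width f j)
    (β := fun j => b j - B * e.width f j)
    (z := fun j => max (a j + B * e.width f j) (inner ℝ (f j) x₀ - 2 * (B * e.width f j)))
    (C := M + B * ∑' j, e.width f j)
    (fun j _ => (abs_add_le _ _).trans (add_le_add (ha j) (hbnd j)))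
    (fun j _ => (abs_sub _ _).trans (add_le_add (hb j) (hbnd j)))
    (summable_sq_of_abs_sub_le (f.summable_sq_coord x₀) ((h.summable_width.mul_left B).mul_left 2)
      (Eventually.of_forall fun j => by
        have h1 := hQ x₀ hx₀ j
        have h2 := hBw j
        rw [abs_le]
        constructor
        · linarith [le_max_right (a j + B * e.width f j)
            (inner ℝ (f j) x₀ - 2 * (B * e.width f j))]
        · rw [sub_le_iff_le_add]
          exact max_le (by linarith [h1.1]) (by linarith)))
    (fun j hj => by
      have h1 := hQ x₀ hx₀ j
      have h2 := hBw j
      have h3 := hp1 j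
      rw [hc, e.margin_of_le f B hj] at h3
      exact ⟨le_max_left _ _, max_lt (by linarith) (by linarith [h1.2])⟩)
    (by
      simp only [htail]
      exact (summable_nat_add_iff n).2 hp2)
  refine ⟨_, hmem, ?_, ?_⟩
  · rintro x ⟨hxU, hxt⟩
    have hT := hG' _ hxU
    have hTi : ∀ i : Fin n, a i + B * e.prefixError f n i + e.slack f n / 2 ≤
          (e.corner f n *ᵥ fun i : Fin n => inner ℝ (e i) x) i ∧
        (e.corner f n *ᵥ fun i : Fin n => inner ℝ (e i) x) i ≤
          b i - B * e.prefixError f n i - e.slack f n / 2 := fun i => by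
      have h1 := hT.1 i
      have h2 := hT.2 i
      simp only [hc, e.margin_of_fin f B i] at h1 h2
      constructor <;> linarith
    have hxB : ∀ i, |inner ℝ (e i) x| ≤ B := by
      refine abs_coord_le_of_corner h hn2 (fun i => ?_) fun j hj => ?_
      · have h1 := hTi i
        have h2 := abs_le.1 (ha i)
        have h3 := abs_le.1 (hb i)
        have h4 := mul_nonneg hB.le (e.prefixError_nonneg f n i)
        exact abs_le.2 ⟨by linarith [h1.1, h2.1], by linarith [h1.2, h3.2]⟩
      · have h1 := hxt j hj
        have h2 := abs_le.1 (ha j)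
        have h3 := abs_le.1 (hb j)
        have h4 := hBw j
        exact abs_le.2 ⟨by linarith [h1.1, h2.1], by linarith [h1.2, h3.2]⟩
    refine hQ' x fun j => ?_
    rcases lt_or_ge j n with hj | hj
    · have h1 := abs_le.1 (abs_coord_sub_corner_le h hxB ⟨j, hj⟩)
      have h2 := hTi ⟨j, hj⟩
      exact ⟨by linarith [h1.1, h2.1], by linarith [h1.2, h2.2]⟩
    · have h1 := abs_lt.1 (abs_coord_sub_lt h hB hxB j)
      have h2 := hxt j hj
      exact ⟨by linarith [h1.1, h2.1], by linarith [h1.2, h2.2]⟩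
  · rw [hmeas]
    simp only [htail]
    have hbox : ∀ i : Fin n, b i - c i - (a i + c i) = b i - a i + -2 * c i := fun i => by ring
    obtain ⟨hv1, -⟩ := volume_preimage_box (e.corner f n) (abs_pos.1 hdet0)
      (p := fun i => a i + c i) (q := fun i => b i - c i)
      (fun i => by
        rw [← sub_nonneg, hbox]
        exact (hp1 i).le)
    simp only [hbox] at hv1
    have hprod : 0 ≤ ∏ i : Fin n, (b i - a i + -2 * c i) :=
      Finset.prod_nonneg fun i _ => (hp1 i).le
    have hvol : ∏ i : Fin n, (b i - a i + -2 * c i) ≤ volume.real (⋃ k' ∈ G, gridCube k k') := by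
      have h1 := measureReal_mono (μ := volume) (fun u hu => hG u hu :
        {u | e.corner f n *ᵥ u ∈ Set.Icc (fun i : Fin n => a i + c i) fun i => b i - c i} ⊆
          ⋃ k' ∈ G, gridCube k k') (volume_biUnion_gridCube_ne_top G)
      rw [hv1] at h1
      refine le_trans ?_ h1
      exact le_mul_of_one_le_left hprod ((one_le_inv₀ hdet0).2 hd2)
    refine hp3.trans ?_
    rw [exp_tsum_log_eq_prod_mul hp1 hp2 n]
    exact mul_le_mul_of_nonneg_right hvol (Real.exp_pos _).le

end HilbertBasis

theorem edgeProduct_congr_equiv {a b a' b' : ℕ → ℝ} (π : Equiv.Perm ℕ)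
    (h : ∀ j, b' j - a' j = b (π j) - a (π j)) : edgeProduct a' b' = edgeProduct a b := by
  have hiff : (Summable fun j => Real.log (b' j - a' j)) ↔
      Summable fun j => Real.log (b j - a j) := by
    simp only [h]
    exact π.summable_iff (f := fun j => Real.log (b j - a j))
  by_cases hs : Summable fun j => Real.log (b j - a j)
  · rw [edgeProduct_eq_exp hs, edgeProduct_eq_exp (hiff.2 hs)]
    simp only [h]
    rw [π.tsum_eq fun j => Real.log (b j - a j)]
  · rw [edgeProduct_eq_zero hs, edgeProduct_eq_zero fun h' => hs (hiff.1 h')]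

theorem max_log_add_le {l w : ℝ} (hl : 0 < l) (hw : 0 ≤ w) :
    max 0 (Real.log (l + w)) ≤ max 0 (Real.log l) + w := by
  refine max_le (add_nonneg (le_max_left _ _) hw) ?_
  rw [Real.log_le_iff_le_exp (by linarith), Real.exp_add]
  have h1 : l ≤ Real.exp (max 0 (Real.log l)) :=
    (Real.log_le_iff_le_exp hl).1 (le_max_right _ _)
  have h2 : 1 ≤ Real.exp (max 0 (Real.log l)) := Real.one_le_exp (le_max_left _ _)
  have h3 := Real.add_one_le_exp w
  nlinarith

theorem summable_log_of_add {l w : ℕ → ℝ} (hl : ∀ j, 0 < l j) (hw0 : ∀ j, 0 ≤ w j)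
    (hw : Summable w) (h : Summable fun j => Real.log (l j + w j)) :
    Summable fun j => Real.log (l j) := by
  have h1 := summable_length_sub_one (fun j => add_pos_of_pos_of_nonneg (hl j) (hw0 j)) h
  have h2 : Summable fun j => l j - 1 := (h1.of_abs.sub hw).congr fun j => by ring
  exact (Real.summable_log_one_add_of_summable h2).congr fun j => by rw [add_sub_cancel]

theorem exists_pos_le_length {l : ℕ → ℝ} (hl : ∀ j, 0 < l j)
    (h : Summable fun j => Real.log (l j)) : ∃ m, 0 < m ∧ ∀ j, m ≤ l j := by
  refine ⟨Real.exp (-∑' j, |Real.log (l j)|), Real.exp_pos _, fun j => ?_⟩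
  rw [← Real.le_log_iff_exp_le (hl j)]
  have := h.abs.le_tsum j fun _ _ => abs_nonneg _
  linarith [neg_abs_le (Real.log (l j))]

namespace HilbertBasis

variable {H : Type*} [NormedAddCommGroup H] [InnerProductSpace ℝ H]

theorem IsClose.exists_null_outer {e f : HilbertBasis ℕ ℝ H} (h : e.IsClose f) {a b : ℕ → ℝ}
    {M : ℝ} (hM : 0 < M) (hab : ∀ j, a j < b j) (ha : ∀ j, |a j| ≤ M) (hb : ∀ j, |b j| ≤ M)
    (hs : Summable fun j => max 0 (Real.log (b j - a j)))
    (hl : ¬ Summable fun j => Real.log (b j - a j)) {Q : Set H}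
    (hQ : ∀ x ∈ Q, ∀ j, inner ℝ (f j) x ∈ Set.Icc (a j) (b j)) (hne : Q.Nonempty) :
    ∃ A ∈ e.rectangleRing, Q ⊆ A ∧ e.ringMeasure A = 0 := by
  have hw0 : ∀ j, 0 ≤ 2 * (M * e.width f j) := fun j =>
    mul_nonneg zero_le_two (mul_pos hM (e.width_pos f j)).le
  have hw : Summable fun j => 2 * (M * e.width f j) := (h.summable_width.mul_left M).mul_left 2
  have hbnd := h.abs_margin_le hM.le
  have hsub : Q ⊆ e.rectangle (fun j => a j - M * e.width f j) fun j => b j + M * e.width f j := by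
    intro x hx j
    have h1 := abs_lt.1 (abs_coord_sub_lt h.symm hM (fun i => (?_ : |inner ℝ (f i) x| ≤ M)) j)
    · rw [width_swap] at h1
      have h2 := hQ x hx j
      exact ⟨by linarith [h1.1, h2.1], by linarith [h1.2, h2.2]⟩
    · have h2 := hQ x hx i
      exact abs_le.2 ⟨(abs_le.1 (ha i)).1.trans h2.1, h2.2.trans (abs_le.1 (hb i)).2⟩
  have hlen : ∀ j, b j + M * e.width f j - (a j - M * e.width f j) =
      b j - a j + 2 * (M * e.width f j) := fun j => by ring
  have hedge : e.IsMeasurableEdges (fun j => a j - M * e.width f j)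
      fun j => b j + M * e.width f j := by
    refine ⟨memℓp_infty_iff.2 ⟨M + M * ∑' j, e.width f j, ?_⟩,
      memℓp_infty_iff.2 ⟨M + M * ∑' j, e.width f j, ?_⟩, hne.mono hsub, ?_⟩
    · rintro _ ⟨j, rfl⟩
      exact (abs_sub _ _).trans (add_le_add (ha j) (hbnd j))
    · rintro _ ⟨j, rfl⟩
      exact (abs_add_le _ _).trans (add_le_add (hb j) (hbnd j))
    · refine Summable.of_nonneg_of_le (fun _ => le_max_left _ _) (fun j => ?_) (hs.add hw)
      rw [hlen]
      exact max_log_add_le (sub_pos.2 (hab j)) (hw0 j)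
  refine ⟨_, e.measurableRectangles_subset (Or.inr ⟨_, _, hedge, rfl⟩), hsub, ?_⟩
  rw [e.isRectangleMeasure_ringMeasure.rectangle _ _ hedge, edgeProduct_eq_zero]
  simp only [hlen]
  exact fun h' => hl (summable_log_of_add (fun j => sub_pos.2 (hab j)) hw0 hw h')

/-- A set between the open and the closed rectangle of a close basis is measurable and its measure
is the product of the edge lengths. -/
theorem IsClose.measure_eq {e f : HilbertBasis ℕ ℝ H} (h : e.IsClose f) {a b : ℕ → ℝ}
    {M : ℝ} (hM : 0 < M) (hab : ∀ j, a j < b j) (ha : ∀ j, |a j| ≤ M) (hb : ∀ j, |b j| ≤ M)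
    (hs : Summable fun j => max 0 (Real.log (b j - a j))) {Q : Set H}
    (hQ : ∀ x ∈ Q, ∀ j, inner ℝ (f j) x ∈ Set.Icc (a j) (b j)) (hne : Q.Nonempty)
    (hQ' : ∀ x, (∀ j, inner ℝ (f j) x ∈ Set.Ioo (a j) (b j)) → x ∈ Q) :
    Q ∈ e.measurableRing ∧ e.measure Q = edgeProduct a b := by
  refine e.mem_measurableRing_of_approx fun ε hε => ?_
  by_cases hl : Summable fun j => Real.log (b j - a j)
  · obtain ⟨m, hm, hml⟩ := exists_pos_le_length (fun j => sub_pos.2 (hab j)) hl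
    set V := edgeProduct a b
    set B := e.coordBound f M
    have hK := e.tendsto_tailWidth f
    have hE : Tendsto (fun n => 4 * ((2 * B + 1) * e.tailWidth f n)) atTop (𝓝 0) := by
      simpa using (hK.const_mul (2 * B + 1)).const_mul 4
    have hexp : Tendsto (fun n => Real.exp (4 * ((2 * B + 1) * e.tailWidth f n) / m)) atTop
        (𝓝 1) := by
      simpa [Function.comp_def] using (Real.continuous_exp.tendsto _).comp (hE.div_const m)
    have hexp' : Tendsto (fun n => Real.exp (-(4 * ((2 * B + 1) * e.tailWidth f n) / m))) atTop
        (𝓝 1) := by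
      simpa [Function.comp_def] using (Real.continuous_exp.tendsto _).comp (hE.div_const m).neg
    have hinv : Tendsto (fun n => (1 - e.tailWidth f n)⁻¹) atTop (𝓝 1) := by
      simpa using (hK.const_sub 1).inv₀ (by norm_num)
    have hup : Tendsto (fun n => (1 - e.tailWidth f n)⁻¹ *
        (V * Real.exp (4 * ((2 * B + 1) * e.tailWidth f n) / m))) atTop (𝓝 V) := by
      simpa using hinv.mul (hexp.const_mul V)
    have hlow : Tendsto (fun n => V * Real.exp (-(4 * ((2 * B + 1) * e.tailWidth f n) / m))) atTop
        (𝓝 V) := by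
      simpa using hexp'.const_mul V
    have hK2 : Tendsto (fun n => 2 * (1 + ∑' j, e.width f j) * e.tailWidth f n) atTop (𝓝 0) := by
      simpa using hK.const_mul (2 * (1 + ∑' j, e.width f j))
    obtain ⟨n, h1, h2, h3, h4, h5⟩ := ((hK.eventually (gt_mem_nhds zero_lt_one)).and
      ((hK2.eventually (ge_mem_nhds zero_lt_one)).and ((hE.eventually (ge_mem_nhds hm)).and
        ((hup.eventually (ge_mem_nhds (show V < V + ε by linarith))).and
          (hlow.eventually (le_mem_nhds (show V - ε < V by linarith))))))).exists
    obtain ⟨A₂, hA₂, hQA, hA₂'⟩ := h.exists_outer hM ha hb hm hml hl hQ hne h1 h3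
    obtain ⟨A₁, hA₁, hAQ, hA₁'⟩ := h.exists_inner hM ha hb hm hml hl hQ hne hQ' h1 h2 h3
    exact ⟨A₁, hA₁, A₂, hA₂, hAQ, hQA, h5.trans hA₁', hA₂'.trans h4⟩
  · obtain ⟨A, hA, hQA, hA0⟩ := h.exists_null_outer hM hab ha hb hs hl hQ hne
    refine ⟨∅, e.isSetRing_rectangleRing.empty_mem, A, hA, Set.empty_subset _, hQA, ?_, ?_⟩
    · rw [edgeProduct_eq_zero hl, addContent_empty]
      linarith
    · rw [edgeProduct_eq_zero hl, hA0]
      linarith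

theorem exists_signed_permutation [CompleteSpace H] (f : HilbertBasis ℕ ℝ H) (π : Equiv.Perm ℕ)
    {s : ℕ → ℝ} (hs : ∀ j, |s j| = 1) :
    ∃ g : HilbertBasis ℕ ℝ H, ∀ j, g j = s j • f (π j) := by
  have hs0 : ∀ j, s j ≠ 0 := fun j h0 => by simpa [h0] using hs j
  have hv : Orthonormal ℝ fun j => s j • f (π j) := by
    refine ⟨fun j => ?_, fun i j hij => ?_⟩
    · rw [norm_smul, Real.norm_eq_abs, hs, f.orthonormal.1, one_mul]
    · beta_reduce
      rw [real_inner_smul_left, real_inner_smul_right,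
        f.orthonormal.2 fun h => hij (π.injective h), mul_zero, mul_zero]
  have hsp : ⊤ ≤ (Submodule.span ℝ (Set.range fun j => s j • f (π j))).topologicalClosure := by
    rw [← f.dense_span]
    refine Submodule.topologicalClosure_mono (Submodule.span_le.2 ?_)
    rintro _ ⟨j, rfl⟩
    have h1 : s (π.symm j) • f (π (π.symm j)) ∈
        Submodule.span ℝ (Set.range fun j => s j • f (π j)) := Submodule.subset_span ⟨_, rfl⟩
    rw [π.apply_symm_apply] at h1
    have h2 := Submodule.smul_mem _ (s (π.symm j))⁻¹ h1
    rwa [smul_smul, inv_mul_cancel₀ (hs0 _), one_smul] at h2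
  exact ⟨HilbertBasis.mk hv hsp, fun j => by rw [HilbertBasis.coe_mk]⟩

theorem mem_measurableRing_of_mem_rectangleRing (e : HilbertBasis ℕ ℝ H) {A : Set H}
    (hA : A ∈ e.rectangleRing) : A ∈ e.measurableRing := fun ε hε =>
  ⟨A, hA, A, hA, subset_rfl, subset_rfl, by rwa [Set.sdiff_self, addContent_empty]⟩

theorem IsMatched.measure_eq [CompleteSpace H] {e f : HilbertBasis ℕ ℝ H} (h : e.IsMatched f)
    {Q : Set H} (hQ : Q ∈ f.measurableRectangles) :
    Q ∈ e.measurableRing ∧ e.measure Q = f.measure Q := by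
  rw [f.measure_eq_ringMeasure (f.measurableRectangles_subset hQ)]
  rcases hQ with rfl | ⟨a, b, hab, rfl⟩
  · have he := e.isSetRing_rectangleRing.empty_mem
    refine ⟨e.mem_measurableRing_of_mem_rectangleRing he, ?_⟩
    rw [e.measure_eq_ringMeasure he, addContent_empty, addContent_empty]
  rw [f.isRectangleMeasure_ringMeasure.rectangle a b hab]
  obtain ⟨π, s, hs, hsum⟩ := h
  obtain ⟨g, hg⟩ := f.exists_signed_permutation π hs
  have hclose : e.IsClose g := by
    refine hsum.congr fun p => ?_
    have h1 : s p.2 * s p.2 = 1 := by rw [← sq, ← sq_abs, hs, one_pow]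
    have h2 : ∀ r : ℝ, |r| = |s p.2 * r| := fun r => by rw [abs_mul, hs, one_mul]
    rw [defect, hg, real_inner_smul_right, h2, mul_sub]
    split_ifs
    · rw [h1]
    · rw [mul_zero]
  obtain ⟨A, hA⟩ := memℓp_infty_iff.1 hab.memℓp_left
  obtain ⟨B, hB⟩ := memℓp_infty_iff.1 hab.memℓp_right
  have ha : ∀ j, |a j| ≤ max 1 (max A B) := fun j =>
    le_max_of_le_right (le_max_of_le_left (hA ⟨j, rfl⟩))
  have hb : ∀ j, |b j| ≤ max 1 (max A B) := fun j =>
    le_max_of_le_right (le_max_of_le_right (hB ⟨j, rfl⟩))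
  have hlt : ∀ j, a j < b j := fun j => by
    obtain ⟨x, hx⟩ := hab.nonempty
    exact (hx j).1.trans_lt (hx j).2
  have hsgn : ∀ j, s j = 1 ∨ s j = -1 := fun j => eq_or_eq_neg_of_abs_eq (hs j)
  have hlen : ∀ j, (if s j = 1 then b (π j) else -a (π j)) -
      (if s j = 1 then a (π j) else -b (π j)) = b (π j) - a (π j) := fun j => by
    split_ifs <;> ring
  have hgx : ∀ x j, inner ℝ (g j) x = s j * inner ℝ (f (π j)) x := fun x j => by
    rw [hg, real_inner_smul_left]
  rw [← edgeProduct_congr_equiv (a' := fun j => if s j = 1 then a (π j) else -b (π j))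
    (b' := fun j => if s j = 1 then b (π j) else -a (π j)) π hlen]
  refine hclose.measure_eq (M := max 1 (max A B)) (lt_max_of_lt_left one_pos) ?_ ?_ ?_ ?_ ?_
    hab.nonempty ?_
  · intro j
    rw [← sub_pos, hlen, sub_pos]
    exact hlt _
  · intro j
    split_ifs
    · exact ha _
    · rw [abs_neg]; exact hb _
  · intro j
    split_ifs
    · exact hb _
    · rw [abs_neg]; exact ha _
  · simp only [hlen]
    exact hab.summable.comp_injective π.injective
  · intro x hx j
    have h1 := hx (π j)
    rw [hgx]
    rcases hsgn j with h | h
    · simp only [h, if_true, one_mul]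
      exact ⟨h1.1, h1.2.le⟩
    · have h2 : ¬ (-1 : ℝ) = 1 := by norm_num
      simp only [h, if_neg h2, neg_mul, one_mul]
      exact ⟨neg_le_neg h1.2.le, neg_le_neg h1.1⟩
  · intro x hx k
    obtain ⟨j, rfl⟩ := π.surjective k
    have h1 := hx j
    rw [hgx] at h1
    rcases hsgn j with h | h
    · simp only [h, if_true, one_mul] at h1
      exact ⟨h1.1.le, h1.2⟩
    · have h2 : ¬ (-1 : ℝ) = 1 := by norm_num
      simp only [h, if_neg h2, neg_mul, one_mul] at h1
      exact ⟨(neg_lt_neg_iff.1 h1.2).le, neg_lt_neg_iff.1 h1.1⟩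

end HilbertBasis

end

theorem theorem4p9 {H : Type*} [NormedAddCommGroup H] [InnerProductSpace ℝ H] [CompleteSpace H]
    (e f : HilbertBasis ℕ ℝ H) (hnear : e.IsNear f) :
    (∀ Q ∈ f.measurableRectangles, Q ∈ e.measurableRing ∧ e.measure Q = f.measure Q) ∧
    (∀ P ∈ e.measurableRectangles, P ∈ f.measurableRing ∧ f.measure P = e.measure P) :=
  ⟨fun _ hQ => hnear.isMatched.measure_eq hQ, fun _ hP => hnear.isMatched.symm.measure_eq hP⟩
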